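/- Let $Y$ be a smooth complex curve (a one-dimensional complex manifold, not necessarily compact or connected), let $\mathcal{E}$ be a holomorphic vector bundle of rank two on $Y$, and let $\rho : X = \mathbb{P}(\mathcal{E}) \to Y$ be its projectivization, the complex surface whose points over $y \in Y$ are the lines through the origin in the fibre $\mathcal{E}_y$. Let $\mathcal{E}nd_0(\mathcal{E})$ be the bundle of traceless endomorphisms of $\mathcal{E}$. For $x = [v] \in X$ with $\rho(x) = y$ and $A \in \mathrm{End}(\mathcal{E}_y)$, let $V_A(x) \in T_xX$ be the velocity at $t = 0$ of the curve $t \mapsto [v + tAv]$ in the fibre $\mathbb{P}(\mathcal{E}_y)$ (that is, the value at $x$ of the vector field on $\mathbb{P}(\mathcal{E}_y)$ induced by the infinitesimal symmetry $A$). (1) There is a unique $\mathbb{C}$-linear isomorphism \[ \Phi : \Gamma(X, \wedge^2 T_X) \xrightarrow{\ \cong\ } \Gamma(Y, T_Y \otimes \mathcal{E}nd_0(\mathcal{E})) \] between the spaces of global holomorphic sections such that, for every $\pi \in \Gamma(X,\wedge^2T_X)$, every $x \in X$, every $\alpha \in T^*_{\rho(x)}Y$ and every $\beta \in T^*_xX$,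 \[ \langle \rho^*\alpha \wedge \beta, \pi \rangle(x) = \beta\big(V_{A}(x)\big), \qquad A = \langle \alpha, \Phi(\pi)(\rho(x)) \rangle \in \mathrm{End}_0(\mathcal{E}_{\rho(x)}). \] (2) Consequently, holomorphic Poisson structures on $X$ (that is, $\mathbb{C}$-bilinear brackets on the sheaf $\mathcal{O}_X$ of holomorphic functions that are skew-symmetric and satisfy the Leibniz rule and the Jacobi identity) are in canonical bijection with holomorphic bundle maps $T^*_Y \to \mathcal{E}nd_0(\mathcal{E})$ over $Y$. Precisely, there is a unique bijection $\Psi$ from the set of Poisson structures on $X$ to the set of such bundle maps with the following property: for each Poisson structure $\{\cdot,\cdot\}$ there are a bivector field $\pi \in \Gamma(X,\wedge^2T_X)$ with $\{f,g\} = \langle df\wedge dg, \pi\rangle$ for all local holomorphic functions $f,g$, and a section $\phi \in \Gamma(Y, T_Y \otimes \mathcal{E}nd_0(\mathcal{E}))$ related to $\pi$ as in (1) (so $\phi=\Phi(\pi)$), such that $\Psi(\{\cdot,\cdot\})$ is the bundle map $\alpha \mapsto \langle \alpha, \phi\rangle$. -/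

import Mathlib

open scoped Manifold ContDiff Bundle Topology TensorProduct

set_option linter.unusedSectionVars false

noncomputable section

namespace RuledSurface

/-! ## The projectivization of a rank-two holomorphic vector bundle -/

section Projectivization

variable {Y : Type*} (E : Y → Type*) [∀ y, AddCommGroup (E y)] [∀ y, Module ℂ (E y)]

/-- The points of `ℙ(E)`: a point `base` of `Y` together with a line through the origin
in the fibre of `E` over it. -/
@[ext]
structure ProjBundle where
  /-- the image of the point under the bundle projection `ℙ(E) → Y` -/
  base : Y
  /-- the line in the fibre `E base` -/
  line : Projectivization ℂ (E base)

end Projectivization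

namespace ProjBundle

/-- The vector in `ℂ²` whose `i`-th coordinate is `1` and whose other coordinate is `z`. -/
def vec (i : Fin 2) (z : ℂ) : Fin 2 → ℂ := fun j => if j = i then 1 else z

theorem vec_ne_zero (i : Fin 2) (z : ℂ) : vec i z ≠ 0 := fun h => by
  simpa [vec] using congrFun h i

theorem eq_smul_vec (i : Fin 2) (w : Fin 2 → ℂ) (h : w i ≠ 0) :
    w = w i • vec i (w (i + 1) / w i) := by
  funext j
  fin_cases i <;> fin_cases j <;> simp_all [vec] <;> field_simp

theorem vec_succ (i : Fin 2) (z : ℂ) : vec i z (i + 1) = z := by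
  fin_cases i <;> simp [vec]

theorem vec_self (i : Fin 2) (z : ℂ) : vec i z i = 1 := by simp [vec]

variable {Y : Type*} [TopologicalSpace Y] [ChartedSpace ℂ Y]
  {E : Y → Type*} [∀ y, AddCommGroup (E y)] [∀ y, Module ℂ (E y)]
  [∀ y, TopologicalSpace (E y)] [TopologicalSpace (Bundle.TotalSpace (Fin 2 → ℂ) E)]
  [FiberBundle (Fin 2 → ℂ) E] [VectorBundle ℂ (Fin 2 → ℂ) E]

/-- The local trivialization of `E` around `y₀`, at the point `y`, as a linear map
(the zero map if `y` is outside the domain of the trivialization). -/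
def triv (y₀ y : Y) : E y →ₗ[ℂ] (Fin 2 → ℂ) :=
  (trivializationAt (Fin 2 → ℂ) E y₀).linearMapAt ℂ y

/-- The inverse of `triv y₀ y`. -/
def trivSymm (y₀ y : Y) : (Fin 2 → ℂ) →ₗ[ℂ] E y :=
  (trivializationAt (Fin 2 → ℂ) E y₀).symmₗ ℂ y

/-- The open set of `Y` on which both the chart and the trivialization around `y₀` live. -/
def dom (E : Y → Type*) [∀ y, TopologicalSpace (E y)]
    [TopologicalSpace (Bundle.TotalSpace (Fin 2 → ℂ) E)] [FiberBundle (Fin 2 → ℂ) E]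
    (y₀ : Y) : Set Y :=
  (chartAt ℂ y₀).source ∩ (trivializationAt (Fin 2 → ℂ) E y₀).baseSet

theorem triv_trivSymm {y₀ y : Y} (hy : y ∈ (trivializationAt (Fin 2 → ℂ) E y₀).baseSet)
    (w : Fin 2 → ℂ) : triv y₀ y (trivSymm (E := E) y₀ y w) = w :=
  Bundle.Trivialization.linearMapAt_symmₗ _ hy w

theorem trivSymm_triv {y₀ y : Y} (hy : y ∈ (trivializationAt (Fin 2 → ℂ) E y₀).baseSet)
    (v : E y) : trivSymm y₀ y (triv y₀ y v) = v :=
  Bundle.Trivialization.symmₗ_linearMapAt _ hy v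

/-- The homogeneous coordinates (of a representative) of the point `x` in the trivialization
around `y₀`. -/
def coord (y₀ : Y) (x : ProjBundle E) : Fin 2 → ℂ := triv y₀ x.base x.line.rep

theorem coord_mk {y₀ y : Y} (v : E y) (hv : v ≠ 0) :
    ∃ a : ℂ, a ≠ 0 ∧ coord y₀ ⟨y, Projectivization.mk ℂ v hv⟩ = a • triv y₀ y v := by
  obtain ⟨a, ha⟩ := Projectivization.exists_smul_eq_mk_rep ℂ v hv
  refine ⟨a, a.ne_zero, ?_⟩
  simp only [coord]
  rw [← ha, Units.smul_def, map_smul]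

theorem coord_ne_zero {y₀ : Y} {x : ProjBundle E}
    (hx : x.base ∈ (trivializationAt (Fin 2 → ℂ) E y₀).baseSet) : coord y₀ x ≠ 0 := by
  intro h
  apply x.line.rep_nonzero
  rw [← trivSymm_triv hx x.line.rep]
  change trivSymm y₀ x.base (coord y₀ x) = 0
  rw [h, map_zero]

open Classical in
/-- The point of `ℙ(E)` over `y` with homogeneous coordinates `vec i z` in the trivialization
around `x₀.base`. (If `y` is outside the domain of the trivialization, the value is the junk
point `x₀`.) -/
def pt (x₀ : ProjBundle E) (i : Fin 2) (y : Y) (z : ℂ) : ProjBundle E :=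
  if h : trivSymm (E := E) x₀.base y (vec i z) ≠ 0 then
    ⟨y, Projectivization.mk ℂ _ h⟩ else x₀

theorem trivSymm_vec_ne_zero {y₀ y : Y}
    (hy : y ∈ (trivializationAt (Fin 2 → ℂ) E y₀).baseSet) (i : Fin 2) (z : ℂ) :
    trivSymm (E := E) y₀ y (vec i z) ≠ 0 := fun h => by
  have := triv_trivSymm hy (vec i z)
  rw [h, map_zero] at this
  exact vec_ne_zero i z this.symm

theorem pt_eq {x₀ : ProjBundle E} {y : Y}
    (hy : y ∈ (trivializationAt (Fin 2 → ℂ) E x₀.base).baseSet) (i : Fin 2) (z : ℂ) :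
    pt x₀ i y z = ⟨y, Projectivization.mk ℂ _ (trivSymm_vec_ne_zero hy i z)⟩ :=
  dif_pos _

theorem pt_coord {x₀ x : ProjBundle E} {i : Fin 2}
    (hx : x.base ∈ (trivializationAt (Fin 2 → ℂ) E x₀.base).baseSet)
    (hi : coord x₀.base x i ≠ 0) :
    pt x₀ i x.base (coord x₀.base x (i + 1) / coord x₀.base x i) = x := by
  rw [pt_eq hx]
  obtain ⟨y, L⟩ := x
  congr 1
  conv_rhs => rw [← L.mk_rep]
  rw [Projectivization.mk_eq_mk_iff']
  refine ⟨(coord x₀.base ⟨y, L⟩ i)⁻¹, ?_⟩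
  have h1 := eq_smul_vec i _ hi
  have h2 : L.rep = trivSymm x₀.base y (coord x₀.base ⟨y, L⟩) := (trivSymm_triv hx L.rep).symm
  rw [h2, h1, map_smul, smul_smul]
  simp only [Pi.smul_apply, vec_self, smul_eq_mul, mul_one, vec_succ]
  rw [inv_mul_cancel₀ hi, one_smul, mul_div_cancel₀ _ hi]

/-- The affine chart of `ℙ(E)` attached to the chart of `Y` and the trivialization of `E` around
`x₀.base` and to the `i`-th standard affine chart of `ℙ¹`: the point over `y` with homogeneous
coordinates `w` is sent to (the coordinate of `y`, `w_{i+1} / w_i`). -/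
def chart (x₀ : ProjBundle E) (i : Fin 2) : PartialEquiv (ProjBundle E) (ℂ × ℂ) where
  toFun x := (chartAt ℂ x₀.base x.base, coord x₀.base x (i + 1) / coord x₀.base x i)
  invFun p := pt x₀ i ((chartAt ℂ x₀.base).symm p.1) p.2
  source := {x | x.base ∈ dom E x₀.base ∧ coord x₀.base x i ≠ 0}
  target := {p | p.1 ∈ (chartAt ℂ x₀.base).target ∧
    (chartAt ℂ x₀.base).symm p.1 ∈ (trivializationAt (Fin 2 → ℂ) E x₀.base).baseSet}
  map_source' := by
    rintro x ⟨⟨hx, hx'⟩, -⟩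
    refine ⟨(chartAt ℂ x₀.base).map_source hx, ?_⟩
    simpa only [(chartAt ℂ x₀.base).left_inv hx] using hx'
  map_target' := by
    rintro ⟨s, z⟩ ⟨hs, hs'⟩
    rw [pt_eq hs']
    refine ⟨⟨(chartAt ℂ x₀.base).map_target hs, hs'⟩, ?_⟩
    obtain ⟨a, ha, h⟩ := coord_mk (y₀ := x₀.base) _ (trivSymm_vec_ne_zero hs' i z)
    rw [h, triv_trivSymm hs']
    simpa [vec_self] using ha
  left_inv' := by
    rintro x ⟨⟨hx, hx'⟩, hi⟩
    simp only [(chartAt ℂ x₀.base).left_inv hx]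
    exact pt_coord hx' hi
  right_inv' := by
    rintro ⟨s, z⟩ ⟨hs, hs'⟩
    rw [pt_eq hs']
    obtain ⟨a, ha, h⟩ := coord_mk (y₀ := x₀.base) _ (trivSymm_vec_ne_zero hs' i z)
    rw [h, triv_trivSymm hs']
    simp [vec_self, vec_succ, (chartAt ℂ x₀.base).right_inv hs, ha]

/-- The change of trivialization of `E` from `y₀` to `y₁`, at the point of `Y` with coordinate `s`
in the chart around `y₀`. -/
def trans (E : Y → Type*) [∀ y, AddCommGroup (E y)] [∀ y, Module ℂ (E y)]
    [∀ y, TopologicalSpace (E y)] [TopologicalSpace (Bundle.TotalSpace (Fin 2 → ℂ) E)]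
    [FiberBundle (Fin 2 → ℂ) E] [VectorBundle ℂ (Fin 2 → ℂ) E]
    (y₀ y₁ : Y) (s : ℂ) : (Fin 2 → ℂ) →L[ℂ] (Fin 2 → ℂ) :=
  (trivializationAt (Fin 2 → ℂ) E y₀).coordChangeL ℂ (trivializationAt (Fin 2 → ℂ) E y₁)
    ((chartAt ℂ y₀).symm s)

/-- The coordinates `s` around `y₀` of points in the domains around `y₀` and around `y₁`. -/
def overlap (E : Y → Type*) [∀ y, TopologicalSpace (E y)]
    [TopologicalSpace (Bundle.TotalSpace (Fin 2 → ℂ) E)] [FiberBundle (Fin 2 → ℂ) E]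
    (y₀ y₁ : Y) : Set ℂ :=
  (chartAt ℂ y₀).target ∩ (chartAt ℂ y₀).symm ⁻¹' (dom E y₀ ∩ dom E y₁)

theorem isOpen_dom (y₀ : Y) : IsOpen (dom E y₀) :=
  (chartAt ℂ y₀).open_source.inter (trivializationAt (Fin 2 → ℂ) E y₀).open_baseSet

theorem isOpen_overlap (y₀ y₁ : Y) : IsOpen (overlap E y₀ y₁) :=
  (chartAt ℂ y₀).isOpen_inter_preimage_symm ((isOpen_dom y₀).inter (isOpen_dom y₁))

theorem triv_trivSymm_trans {y₀ y₁ : Y} {s : ℂ} (hs : s ∈ overlap E y₀ y₁) (w : Fin 2 → ℂ) :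
    triv y₁ ((chartAt ℂ y₀).symm s) (trivSymm (E := E) y₀ ((chartAt ℂ y₀).symm s) w) =
      trans E y₀ y₁ s w := by
  have hb : (chartAt ℂ y₀).symm s ∈ (trivializationAt (Fin 2 → ℂ) E y₀).baseSet ∩
      (trivializationAt (Fin 2 → ℂ) E y₁).baseSet := ⟨hs.2.1.2, hs.2.2.2⟩
  rw [triv, trivSymm, trans, ContinuousLinearEquiv.coe_coe,
    Bundle.Trivialization.coordChangeL_apply _ _ hb,
    Bundle.Trivialization.linearMapAt_apply, if_pos hb.2, Bundle.Trivialization.symmₗ_apply _ hb.1]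

theorem coord_pt {x₀ x₁ : ProjBundle E} {i : Fin 2} {s : ℂ} (hs : s ∈ overlap E x₀.base x₁.base)
    (z : ℂ) : ∃ a : ℂ, a ≠ 0 ∧
      coord x₁.base (pt x₀ i ((chartAt ℂ x₀.base).symm s) z) =
        a • trans E x₀.base x₁.base s (vec i z) := by
  rw [pt_eq hs.2.1.2, ← triv_trivSymm_trans hs]
  exact coord_mk _ _

theorem chart_trans_source (x₀ x₁ : ProjBundle E) (i j : Fin 2) :
    ((chart x₀ i).symm.trans (chart x₁ j)).source =
      {p : ℂ × ℂ | p.1 ∈ overlap E x₀.base x₁.base ∧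
        trans E x₀.base x₁.base p.1 (vec i p.2) j ≠ 0} := by
  ext ⟨s, z⟩
  simp only [PartialEquiv.trans_source, PartialEquiv.symm_source, Set.mem_inter_iff,
    Set.mem_preimage, Set.mem_ofPred_eq]
  constructor
  · rintro ⟨⟨hs, hs'⟩, hd, hj⟩
    have hd' : (chartAt ℂ x₀.base).symm s ∈ dom E x₁.base := by
      change (pt x₀ i ((chartAt ℂ x₀.base).symm s) z).base ∈ _ at hd
      rwa [pt_eq hs'] at hd
    have ho : s ∈ overlap E x₀.base x₁.base :=
      ⟨hs, ⟨(chartAt ℂ x₀.base).map_target hs, hs'⟩, hd'⟩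
    obtain ⟨a, ha, h⟩ := coord_pt (x₀ := x₀) (x₁ := x₁) (i := i) ho z
    change coord x₁.base (pt x₀ i ((chartAt ℂ x₀.base).symm s) z) j ≠ 0 at hj
    rw [h] at hj
    exact ⟨ho, (mul_ne_zero_iff.1 hj).2⟩
  · rintro ⟨ho, hj⟩
    refine ⟨⟨ho.1, ho.2.1.2⟩, ?_, ?_⟩
    · change (pt x₀ i ((chartAt ℂ x₀.base).symm s) z).base ∈ _
      rw [pt_eq ho.2.1.2]
      exact ho.2.2
    · obtain ⟨a, ha, h⟩ := coord_pt (x₀ := x₀) (x₁ := x₁) (i := i) ho z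
      change coord x₁.base (pt x₀ i ((chartAt ℂ x₀.base).symm s) z) j ≠ 0
      rw [h]
      exact mul_ne_zero ha hj

theorem chart_trans_eqOn (x₀ x₁ : ProjBundle E) (i j : Fin 2) :
    Set.EqOn ((chart x₀ i).symm.trans (chart x₁ j))
      (fun p : ℂ × ℂ => (chartAt ℂ x₁.base ((chartAt ℂ x₀.base).symm p.1),
        trans E x₀.base x₁.base p.1 (vec i p.2) (j + 1) /
          trans E x₀.base x₁.base p.1 (vec i p.2) j))
      ((chart x₀ i).symm.trans (chart x₁ j)).source := by
  intro p hp
  rw [chart_trans_source] at hp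
  obtain ⟨ho, hj⟩ := hp
  obtain ⟨a, ha, h⟩ := coord_pt (x₀ := x₀) (x₁ := x₁) (i := i) ho p.2
  change (chartAt ℂ x₁.base (pt x₀ i ((chartAt ℂ x₀.base).symm p.1) p.2).base,
    coord x₁.base (pt x₀ i ((chartAt ℂ x₀.base).symm p.1) p.2) (j + 1) /
      coord x₁.base (pt x₀ i ((chartAt ℂ x₀.base).symm p.1) p.2) j) = _
  rw [h, Pi.smul_apply, Pi.smul_apply, smul_eq_mul, smul_eq_mul, mul_div_mul_left _ _ ha,
    pt_eq ho.2.1.2]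

variable [IsManifold 𝓘(ℂ) ω Y] [ContMDiffVectorBundle ω (Fin 2 → ℂ) E 𝓘(ℂ)]

theorem contDiffOn_trans (y₀ y₁ : Y) : ContDiffOn ℂ ω (trans E y₀ y₁) (overlap E y₀ y₁) := by
  rw [← contMDiffOn_iff_contDiffOn]
  refine (contMDiffOn_coordChangeL (n := ω) (IB := 𝓘(ℂ))
    (trivializationAt (Fin 2 → ℂ) E y₀) (trivializationAt (Fin 2 → ℂ) E y₁)).comp
    ((contMDiffOn_chart_symm (I := 𝓘(ℂ)) (n := ω) (x := y₀)).mono fun s hs => hs.1) ?_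
  exact fun s hs => ⟨hs.2.1.2, hs.2.2.2⟩

theorem contDiffOn_base (y₀ y₁ : Y) :
    ContDiffOn ℂ ω (fun s => chartAt ℂ y₁ ((chartAt ℂ y₀).symm s)) (overlap E y₀ y₁) := by
  rw [← contMDiffOn_iff_contDiffOn]
  refine (contMDiffOn_chart (I := 𝓘(ℂ)) (n := ω) (x := y₁)).comp
    ((contMDiffOn_chart_symm (I := 𝓘(ℂ)) (n := ω) (x := y₀)).mono fun s hs => hs.1) ?_
  exact fun s hs => hs.2.2.1

theorem contDiff_vec (i : Fin 2) : ContDiff ℂ ω (vec i) := by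
  rw [contDiff_pi]
  intro j
  by_cases h : j = i
  · simp only [vec, h, if_true]
    exact contDiff_const
  · simp only [vec, h, if_false]
    exact contDiff_id

theorem contDiffOn_coord (x₀ x₁ : ProjBundle E) (i j : Fin 2) :
    ContDiffOn ℂ ω (fun p : ℂ × ℂ => trans E x₀.base x₁.base p.1 (vec i p.2) j)
      {p : ℂ × ℂ | p.1 ∈ overlap E x₀.base x₁.base} := by
  have h1 : ContDiffOn ℂ ω (fun p : ℂ × ℂ => trans E x₀.base x₁.base p.1)
      {p : ℂ × ℂ | p.1 ∈ overlap E x₀.base x₁.base} :=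
    (contDiffOn_trans x₀.base x₁.base).comp contDiffOn_fst fun p hp => hp
  have h2 : ContDiffOn ℂ ω (fun p : ℂ × ℂ => vec i p.2)
      {p : ℂ × ℂ | p.1 ∈ overlap E x₀.base x₁.base} :=
    ((contDiff_vec i).comp contDiff_snd).contDiffOn
  exact contDiffOn_pi.1 (h1.clm_apply h2) j

theorem isOpen_chart_trans_source (x₀ x₁ : ProjBundle E) (i j : Fin 2) :
    IsOpen ((chart x₀ i).symm.trans (chart x₁ j)).source := by
  rw [chart_trans_source]
  have ho : IsOpen {p : ℂ × ℂ | p.1 ∈ overlap E x₀.base x₁.base} :=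
    (isOpen_overlap x₀.base x₁.base).preimage continuous_fst
  exact (contDiffOn_coord x₀ x₁ i j).continuousOn.isOpen_inter_preimage ho isOpen_compl_singleton

theorem contDiffOn_chart_trans (x₀ x₁ : ProjBundle E) (i j : Fin 2) :
    ContDiffOn ℂ ω ((chart x₀ i).symm.trans (chart x₁ j))
      ((chart x₀ i).symm.trans (chart x₁ j)).source := by
  refine ContDiffOn.congr ?_ (chart_trans_eqOn x₀ x₁ i j)
  rw [chart_trans_source]
  refine ContDiffOn.prodMk ?_ ?_
  · exact (contDiffOn_base (E := E) x₀.base x₁.base).comp contDiffOn_fst fun p hp => hp.1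
  · refine ContDiffOn.div ?_ ?_ fun p hp => hp.2
    · exact (contDiffOn_coord x₀ x₁ i (j + 1)).mono fun p hp => hp.1
    · exact (contDiffOn_coord x₀ x₁ i j).mono fun p hp => hp.1

open Classical in
/-- An index of a non-vanishing homogeneous coordinate of `x`. -/
def idx (x : ProjBundle E) : Fin 2 := if coord x.base x 0 ≠ 0 then 0 else 1

theorem coord_idx (x : ProjBundle E) : coord x.base x (idx x) ≠ 0 := by
  unfold idx
  split_ifs with h
  · exact h
  · intro h1
    refine coord_ne_zero (FiberBundle.mem_baseSet_trivializationAt (Fin 2 → ℂ) E x.base) ?_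
    funext j
    fin_cases j
    · exact not_not.1 h
    · exact h1

variable (E) in
/-- The affine charts form a holomorphic atlas of `ℙ(E)`. -/
def core : ChartedSpaceCore (ℂ × ℂ) (ProjBundle E) where
  atlas := Set.range fun p : ProjBundle E × Fin 2 => chart p.1 p.2
  chartAt x := chart x (idx x)
  mem_chart_source x := ⟨⟨mem_chart_source ℂ x.base,
    FiberBundle.mem_baseSet_trivializationAt (Fin 2 → ℂ) E x.base⟩, coord_idx x⟩
  chart_mem_atlas x := ⟨(x, idx x), rfl⟩
  open_source := by
    rintro _ _ ⟨p, rfl⟩ ⟨q, rfl⟩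
    exact isOpen_chart_trans_source p.1 q.1 p.2 q.2
  continuousOn_toFun := by
    rintro _ _ ⟨p, rfl⟩ ⟨q, rfl⟩
    exact (contDiffOn_chart_trans p.1 q.1 p.2 q.2).continuousOn

instance : TopologicalSpace (ProjBundle E) := (core E).toTopologicalSpace

instance : ChartedSpace (ℂ × ℂ) (ProjBundle E) := (core E).toChartedSpace

/-- `ℙ(E)` is a complex surface. -/
instance : IsManifold 𝓘(ℂ, ℂ × ℂ) ω (ProjBundle E) := by
  refine isManifold_of_contDiffOn _ _ _ ?_
  intro e e' he he'
  have h : ∀ e ∈ atlas (ℂ × ℂ) (ProjBundle E), ∃ p : ProjBundle E × Fin 2,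
      e.toPartialEquiv = chart p.1 p.2 := by
    intro e he
    change e ∈ (⋃ (e : PartialEquiv (ProjBundle E) (ℂ × ℂ)) (he : e ∈ (core E).atlas),
      {(core E).openPartialHomeomorph e he}) at he
    simp only [Set.mem_iUnion, Set.mem_singleton_iff] at he
    obtain ⟨_, ⟨p, rfl⟩, rfl⟩ := he
    exact ⟨p, rfl⟩
  obtain ⟨p, hp⟩ := h e he
  obtain ⟨q, hq⟩ := h e' he'
  have key := contDiffOn_chart_trans p.1 q.1 p.2 q.2
  rw [← hp, ← hq] at key
  simpa using key

end ProjBundle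

/-! ## Holomorphic bivector fields and Poisson structures on a complex manifold -/

section ComplexManifold

variable (V : Type*) [NormedAddCommGroup V] [NormedSpace ℂ V]
  {M : Type*} [TopologicalSpace M] [ChartedSpace V M]

/-- The ring of holomorphic functions on an open set `U` of a complex manifold. -/
abbrev Hol (U : TopologicalSpace.Opens M) : Type _ := C^ω⟮𝓘(ℂ, V), U; 𝓘(ℂ), ℂ⟯

variable {V}

/-- The restriction of holomorphic functions to a smaller open set. -/
def Hol.res {U W : TopologicalSpace.Opens M} (h : W ≤ U) (f : Hol V U) : Hol V W :=
  ContMDiffMap.restrictRingHom 𝓘(ℂ, V) 𝓘(ℂ) ℂ h f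

/-- The differential at `x ∈ U` of a holomorphic function on `U`, as a covector of the ambient
manifold. (The extension by zero outside the open set `U` only serves to have a function
on the whole manifold; the derivative at a point of `U` depends only on the germ there.) -/
def Hol.d {U : TopologicalSpace.Opens M} (f : Hol V U) (x : M) :
    TangentSpace 𝓘(ℂ, V) x →L[ℂ] ℂ :=
  mfderiv 𝓘(ℂ, V) 𝓘(ℂ) (Function.extend Subtype.val (f : U → ℂ) 0) x

variable (V M) in
/-- A holomorphic Poisson structure: a `ℂ`-bilinear bracket on the sheaf of holomorphic functions
(compatible with restrictions) that is skew-symmetric and satisfies the Leibniz rule and the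
Jacobi identity. -/
@[ext]
structure PoissonStructure where
  /-- the bracket of holomorphic functions on an open set -/
  bracket : ∀ U : TopologicalSpace.Opens M, Hol V U →ₗ[ℂ] Hol V U →ₗ[ℂ] Hol V U
  bracket_res : ∀ (U W : TopologicalSpace.Opens M) (h : W ≤ U) (f g : Hol V U),
    (bracket U f g).res h = bracket W (f.res h) (g.res h)
  skew : ∀ (U : TopologicalSpace.Opens M) (f g : Hol V U), bracket U f g = -bracket U g f
  leibniz : ∀ (U : TopologicalSpace.Opens M) (f g h : Hol V U),
    bracket U f (g * h) = bracket U f g * h + g * bracket U f h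
  jacobi : ∀ (U : TopologicalSpace.Opens M) (f g h : Hol V U),
    bracket U f (bracket U g h) + bracket U g (bracket U h f) + bracket U h (bracket U f g) = 0

/-- The pairing `⟨α ∧ β, η⟩` of covectors with a bivector, normalized by
`⟨α ∧ β, v ∧ w⟩ = α v * β w - α w * β v`. -/
def wedgePairing {T : Type*} [AddCommGroup T] [Module ℂ T] (α β : Module.Dual ℂ T)
    (η : ⋀[ℂ]^2 T) : ℂ :=
  exteriorPower.pairingDual ℂ T 2 (exteriorPower.ιMulti ℂ 2 ![α, β]) η

theorem wedgePairing_ιMulti {T : Type*} [AddCommGroup T] [Module ℂ T] (α β : Module.Dual ℂ T)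
    (v w : T) :
    wedgePairing α β (exteriorPower.ιMulti ℂ 2 ![v, w]) = α v * β w - α w * β v := by
  simp [wedgePairing, Matrix.det_fin_two, mul_comm]

variable [IsManifold 𝓘(ℂ, V) ω M]

/-- `Z` is holomorphic on `U` as a vector field. -/
def IsHolVectorField (Z : ∀ x : M, TangentSpace 𝓘(ℂ, V) x) (U : Set M) : Prop :=
  ContMDiffOn 𝓘(ℂ, V) 𝓘(ℂ, V).tangent ω
    (fun x => (⟨x, Z x⟩ : TangentBundle 𝓘(ℂ, V) M)) U

theorem IsHolVectorField.smul {Z : ∀ x : M, TangentSpace 𝓘(ℂ, V) x} {U : Set M}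
    (h : IsHolVectorField Z U) (c : ℂ) : IsHolVectorField (fun x => c • Z x) U :=
  ContMDiffOn.const_smul_section (a := c) h

theorem IsHolVectorField.mono {Z : ∀ x : M, TangentSpace 𝓘(ℂ, V) x} {U W : Set M}
    (h : IsHolVectorField Z U) (hW : W ⊆ U) : IsHolVectorField Z W :=
  ContMDiffOn.mono h hW

variable (V M) in
/-- `Γ(M, ∧²T_M)`: the global sections of `∧²T_M` which locally are finite sums `∑ Zᵢ ∧ Wᵢ`
with holomorphic vector fields `Zᵢ`, `Wᵢ`. -/
def bivectorFields : Submodule ℂ (∀ x : M, ⋀[ℂ]^2 (TangentSpace 𝓘(ℂ, V) x)) where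
  carrier := {η | ∀ x₀ : M, ∃ U : Set M, IsOpen U ∧ x₀ ∈ U ∧
    ∃ (n : ℕ) (Z W : Fin n → ∀ x : M, TangentSpace 𝓘(ℂ, V) x),
      (∀ i, IsHolVectorField (Z i) U) ∧ (∀ i, IsHolVectorField (W i) U) ∧
      ∀ x ∈ U, η x = ∑ i, exteriorPower.ιMulti ℂ 2 ![Z i x, W i x]}
  zero_mem' := fun _ => ⟨Set.univ, isOpen_univ, trivial, 0, Fin.elim0, Fin.elim0,
    fun i => i.elim0, fun i => i.elim0, fun _ _ => by simp⟩
  add_mem' := by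
    intro η η' h h' x₀
    obtain ⟨U, hU, hx, n, Z, W, hZ, hW, he⟩ := h x₀
    obtain ⟨U', hU', hx', n', Z', W', hZ', hW', he'⟩ := h' x₀
    refine ⟨U ∩ U', hU.inter hU', ⟨hx, hx'⟩, n + n', Fin.append Z Z', Fin.append W W',
      ?_, ?_, ?_⟩
    · intro i
      refine Fin.addCases (fun i => ?_) (fun i => ?_) i
      · simpa using (hZ i).mono Set.inter_subset_left
      · simpa using (hZ' i).mono Set.inter_subset_right
    · intro i
      refine Fin.addCases (fun i => ?_) (fun i => ?_) i
      · simpa using (hW i).mono Set.inter_subset_left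
      · simpa using (hW' i).mono Set.inter_subset_right
    · intro x hx
      simp [Fin.sum_univ_add, he x hx.1, he' x hx.2]
  smul_mem' := by
    intro c η h x₀
    obtain ⟨U, hU, hx, n, Z, W, hZ, hW, he⟩ := h x₀
    refine ⟨U, hU, hx, n, fun i x => c • Z i x, W, fun i => (hZ i).smul c, hW, ?_⟩
    intro x hx
    rw [Pi.smul_apply, he x hx, Finset.smul_sum]
    refine Finset.sum_congr rfl fun i _ => ?_
    have h0 : ∀ v : TangentSpace 𝓘(ℂ, V) x,
        Function.update ![Z i x, W i x] 0 v = ![v, W i x] := fun v => by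
      funext j
      fin_cases j <;> rfl
    have h1 := (exteriorPower.ιMulti ℂ 2 (M := TangentSpace 𝓘(ℂ, V) x)).map_update_smul
      ![Z i x, W i x] 0 c (Z i x)
    rw [h0, h0] at h1
    exact h1.symm

/-- The bivector field `η` encodes the Poisson structure `P`: `{f, g} = ⟨df ∧ dg, η⟩`. -/
def PoissonStructure.EncodedBy (P : PoissonStructure V M) (η : bivectorFields V M) : Prop :=
  ∀ (U : TopologicalSpace.Opens M) (f g : Hol V U) (x : U),
    P.bracket U f g x = wedgePairing (f.d x.1 : Module.Dual ℂ (TangentSpace 𝓘(ℂ, V) x.1))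
      (g.d x.1 : Module.Dual ℂ (TangentSpace 𝓘(ℂ, V) x.1)) (η.1 x.1)

end ComplexManifold

/-! ## Traceless endomorphisms of a vector bundle over a curve -/

section Traceless

variable {Y : Type*} [TopologicalSpace Y] [ChartedSpace ℂ Y] [IsManifold 𝓘(ℂ) ω Y]
  (E : Y → Type*) [∀ y, AddCommGroup (E y)] [∀ y, Module ℂ (E y)]
  [∀ y, TopologicalSpace (E y)] [∀ y, IsTopologicalAddGroup (E y)]
  [∀ y, ContinuousSMul ℂ (E y)]

/-- The fibre of `End₀(E)` at `y`: the traceless endomorphisms of `E y`. -/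
def End₀ (y : Y) : Submodule ℂ (E y →L[ℂ] E y) where
  carrier := {A | LinearMap.trace ℂ (E y) (A : E y →ₗ[ℂ] E y) = 0}
  zero_mem' := by simp
  add_mem' := by
    intro A B hA hB
    simp only [Set.mem_ofPred_eq] at hA hB
    simp [hA, hB]
  smul_mem' := by
    intro c A hA
    simp only [Set.mem_ofPred_eq] at hA
    simp [hA]

variable {E}

/-- Contraction of the `T_y Y` factor of `T_y Y ⊗ End₀(E y)` with a covector. -/
def contract {y : Y} (α : TangentSpace 𝓘(ℂ) y →L[ℂ] ℂ) :
    TangentSpace 𝓘(ℂ) y ⊗[ℂ] End₀ E y →ₗ[ℂ] End₀ E y :=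
  (TensorProduct.lid ℂ (End₀ E y)).toLinearMap ∘ₗ
    (α : TangentSpace 𝓘(ℂ) y →ₗ[ℂ] ℂ).rTensor (End₀ E y)

theorem contract_tmul {y : Y} (α : TangentSpace 𝓘(ℂ) y →L[ℂ] ℂ) (v : TangentSpace 𝓘(ℂ) y)
    (A : End₀ E y) : contract α (v ⊗ₜ A) = α v • A := by
  simp [contract]

variable [TopologicalSpace (Bundle.TotalSpace (Fin 2 → ℂ) E)]
  [FiberBundle (Fin 2 → ℂ) E] [VectorBundle ℂ (Fin 2 → ℂ) E]

/-- `A` is holomorphic on `U` as a section of the bundle `End(E)`. -/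
def IsHolEnd₀ (A : ∀ y, End₀ E y) (U : Set Y) : Prop :=
  ContMDiffOn 𝓘(ℂ) (𝓘(ℂ).prod 𝓘(ℂ, (Fin 2 → ℂ) →L[ℂ] (Fin 2 → ℂ))) ω
    (fun y => Bundle.TotalSpace.mk' ((Fin 2 → ℂ) →L[ℂ] (Fin 2 → ℂ))
      (E := fun y => E y →L[ℂ] E y) y (A y).1) U

variable (E) in
/-- `Γ(Y, T_Y ⊗ End₀(E))`: the global sections of `T_Y ⊗ End₀(E)` which locally are finite sums
`∑ Zᵢ ⊗ Aᵢ` with holomorphic vector fields `Zᵢ` and holomorphic sections `Aᵢ` of `End₀(E)`. -/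
def vectorTensorEnd₀ : Submodule ℂ (∀ y : Y, TangentSpace 𝓘(ℂ) y ⊗[ℂ] End₀ E y) where
  carrier := {φ | ∀ y₀ : Y, ∃ U : Set Y, IsOpen U ∧ y₀ ∈ U ∧
    ∃ (n : ℕ) (Z : Fin n → ∀ y : Y, TangentSpace 𝓘(ℂ) y) (A : Fin n → ∀ y : Y, End₀ E y),
      (∀ i, IsHolVectorField (Z i) U) ∧ (∀ i, IsHolEnd₀ (A i) U) ∧
      ∀ y ∈ U, φ y = ∑ i, Z i y ⊗ₜ A i y}
  zero_mem' := fun _ => ⟨Set.univ, isOpen_univ, trivial, 0, Fin.elim0, Fin.elim0,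
    fun i => i.elim0, fun i => i.elim0, fun _ _ => by simp⟩
  add_mem' := by
    intro φ φ' h h' y₀
    obtain ⟨U, hU, hy, n, Z, A, hZ, hA, he⟩ := h y₀
    obtain ⟨U', hU', hy', n', Z', A', hZ', hA', he'⟩ := h' y₀
    refine ⟨U ∩ U', hU.inter hU', ⟨hy, hy'⟩, n + n', Fin.append Z Z', Fin.append A A',
      ?_, ?_, ?_⟩
    · intro i
      refine Fin.addCases (fun i => ?_) (fun i => ?_) i
      · simpa using (hZ i).mono Set.inter_subset_left
      · simpa using (hZ' i).mono Set.inter_subset_right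
    · intro i
      refine Fin.addCases (fun i => ?_) (fun i => ?_) i
      · rw [Fin.append_left]
        exact ContMDiffOn.mono (hA i) Set.inter_subset_left
      · rw [Fin.append_right]
        exact ContMDiffOn.mono (hA' i) Set.inter_subset_right
    · intro y hy
      simp [Fin.sum_univ_add, he y hy.1, he' y hy.2]
  smul_mem' := by
    intro c φ h y₀
    obtain ⟨U, hU, hy, n, Z, A, hZ, hA, he⟩ := h y₀
    refine ⟨U, hU, hy, n, fun i y => c • Z i y, A, fun i => (hZ i).smul c, hA, ?_⟩
    intro y hy
    rw [Pi.smul_apply, he y hy, Finset.smul_sum]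
    rfl

variable (E) in
/-- The holomorphic bundle maps `T*_Y → End₀(E)` over `Y`: families of linear maps
`T*_y Y → End₀(E y)` which, as a section of the bundle `Hom(T*_Y, End(E))`, are holomorphic. -/
def CotangentToEnd₀ : Type _ :=
  {θ : ∀ y : Y, (TangentSpace 𝓘(ℂ) y →L[ℂ] ℂ) →L[ℂ] End₀ E y //
    ContMDiff 𝓘(ℂ) (𝓘(ℂ).prod 𝓘(ℂ, (ℂ →L[ℂ] ℂ) →L[ℂ] ((Fin 2 → ℂ) →L[ℂ] (Fin 2 → ℂ)))) ω
      (fun y => Bundle.TotalSpace.mk' ((ℂ →L[ℂ] ℂ) →L[ℂ] ((Fin 2 → ℂ) →L[ℂ] (Fin 2 → ℂ)))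
        (E := fun y : Y => (TangentSpace 𝓘(ℂ) y →L[ℂ] ℂ) →L[ℂ] (E y →L[ℂ] E y)) y
        ((End₀ E y).subtypeL ∘L θ y))}

end Traceless

/-! ## Comparing bivector fields on `ℙ(E)` with sections of `T_Y ⊗ End₀(E)` -/

section Comparison

variable {Y : Type*} [TopologicalSpace Y] [ChartedSpace ℂ Y] [IsManifold 𝓘(ℂ) ω Y]
  {E : Y → Type*} [∀ y, AddCommGroup (E y)] [∀ y, Module ℂ (E y)]
  [∀ y, TopologicalSpace (E y)] [TopologicalSpace (Bundle.TotalSpace (Fin 2 → ℂ) E)]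
  [FiberBundle (Fin 2 → ℂ) E] [VectorBundle ℂ (Fin 2 → ℂ) E]
  [ContMDiffVectorBundle ω (Fin 2 → ℂ) E 𝓘(ℂ)]

open Classical in
/-- The curve `t ↦ [v + t A v]` in the fibre of `ℙ(E)` through `x = [v]`
(near `t = 0`; the junk value where `v + t A v = 0` is `x`). It has the same velocity at `t = 0`
as `t ↦ [exp(t A) v]`. -/
def orbit (x : ProjBundle E) (A : E x.base →L[ℂ] E x.base) (t : ℂ) : ProjBundle E :=
  if h : x.line.rep + t • A x.line.rep ≠ 0 then
    ⟨x.base, Projectivization.mk ℂ (x.line.rep + t • A x.line.rep) h⟩ else x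

theorem orbit_zero (x : ProjBundle E) (A : E x.base →L[ℂ] E x.base) : orbit x A 0 = x := by
  obtain ⟨y, L⟩ := x
  simp [orbit, L.rep_nonzero, L.mk_rep]

/-- The value at `x` of the vector field on the fibre `ℙ(E_y)` through `x` induced by the
infinitesimal symmetry `A ∈ End(E_y)`: the velocity at `t = 0` of `t ↦ [v + t A v]`. -/
def fundamentalVector (x : ProjBundle E) (A : E x.base →L[ℂ] E x.base) :
    TangentSpace 𝓘(ℂ, ℂ × ℂ) x :=
  mfderiv 𝓘(ℂ) 𝓘(ℂ, ℂ × ℂ) (orbit x A) 0 (1 : ℂ)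

/-- The pull-back to `x ∈ ℙ(E)` of a covector on `Y` at the image of `x` along the bundle
projection. -/
def pullbackCovector (x : ProjBundle E) (α : TangentSpace 𝓘(ℂ) x.base →L[ℂ] ℂ) :
    TangentSpace 𝓘(ℂ, ℂ × ℂ) x →L[ℂ] ℂ :=
  α ∘L mfderiv 𝓘(ℂ, ℂ × ℂ) 𝓘(ℂ) (ProjBundle.base : ProjBundle E → Y) x

/-- The canonical relation between a bivector field `η` on `ρ : ℙ(E) → Y` and a section `φ` of
`T_Y ⊗ End₀(E)`: at every `x ∈ ℙ(E)`, for every covector `α` of `Y` at `ρ(x)`, the contraction of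
`η` with `ρ^*α` is the value at `x` of the vector field on the fibre of `ρ` induced by the
endomorphism `⟨α, φ⟩`. -/
def Corresponds [∀ y, IsTopologicalAddGroup (E y)] [∀ y, ContinuousSMul ℂ (E y)]
    (η : bivectorFields (ℂ × ℂ) (ProjBundle E)) (φ : vectorTensorEnd₀ E) : Prop :=
  ∀ (x : ProjBundle E) (α : TangentSpace 𝓘(ℂ) x.base →L[ℂ] ℂ)
    (β : TangentSpace 𝓘(ℂ, ℂ × ℂ) x →L[ℂ] ℂ),
    wedgePairing (pullbackCovector x α : Module.Dual ℂ (TangentSpace 𝓘(ℂ, ℂ × ℂ) x))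
        (β : Module.Dual ℂ (TangentSpace 𝓘(ℂ, ℂ × ℂ) x)) (η.1 x) =
      β (fundamentalVector x (contract α (φ.1 x.base)).1)

end Comparison

end RuledSurface

end

/-! Part (1) is a computation on the fibres of `ℙ(E)`. Over an open set of `Y` with coordinate `s`
and a trivialization of `E`, two affine charts `(s, z)` and `(s, 1/z)`, with `z = w₁ / w₀`, cover
`ℙ(E)`. A bivector is `f ∂_s ∧ ∂_z` in the first chart and has a coefficient `g` in the second.
Since `d(1/z) = -z⁻² dz`, on each fibre `f` and `g` are entire functions with `f(z) = -z² g(1/z)`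
(`bivCoeff_affineChart_one`). By Liouville, `f = p + r z - q z²` (`eq_quadratic_of_differentiable`):
this is `H⁰(ℙ¹, 𝒪(2)) ≅ sl₂`, because such a polynomial is the vector field on the affine line
induced by exactly one traceless matrix (`affineField_zero_quadMatrix`, `eq_quadMatrix`).

The relation `Corresponds` is free of coordinates, and at a point it amounts to one scalar equation
in any affine chart: the coefficient of the bivector is the vector field induced by the matrix of
the endomorphism (`correspondsAt_iff`). Objects can therefore be built pointwise with a chart
depending on the point, with no gluing, and their holomorphy read off in a fixed chart. The numbers
`p`, `q`, `r` are combinations of values of `f` at `0`, `1` and of `g` at `0`, so they depend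
holomorphically on the point of `Y`. The same three values give uniqueness, and linearity of `Φ`
follows from uniqueness.

For part (2), a point derivation of the holomorphic functions kills every function with zero
differential, by Hadamard's lemma (`PointDerivation.app_eq_zero`). Hence a skew biderivation on a
surface comes from a bivector field, with coefficient the bracket of the two coordinates. Its
Jacobiator is a derivation in each slot, so it depends only on three covectors in a two-dimensional
space and vanishes: the Jacobi identity imposes no condition. Finally `T_Y` is a line bundle, so
sections of `T_Y ⊗ End₀(E)` are bundle maps `T*_Y → End₀(E)`, and `Ψ` is the composite of these
bijections. -/

open scoped Manifold ContDiff Bundle Topology TensorProduct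

noncomputable section

namespace RuledSurface

open TopologicalSpace (Opens)

/-! ### Linear algebra of bivectors in two dimensions. -/

section LinearAlgebra

variable {T N : Type*} [AddCommGroup T] [Module ℂ T] [AddCommGroup N] [Module ℂ N]

/-- Stated for any alternating map because it is applied both to wedges of vectors and to wedges of
covectors. -/
theorem alternating_expand (f : T [⋀^Fin 2]→ₗ[ℂ] N) (D₁ D₂ : T) (p q r s : ℂ) :
    f ![p • D₁ + q • D₂, r • D₁ + s • D₂] = (p * s - q * r) • f ![D₁, D₂] := by
  have upd0 : ∀ u w v : T, Function.update ![u, w] 0 v = ![v, w] := fun u w v => by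
    funext j
    fin_cases j <;> rfl
  have upd1 : ∀ u w v : T, Function.update ![u, w] 1 v = ![u, v] := fun u w v => by
    funext j
    fin_cases j <;> rfl
  have add_left : ∀ u v w, f ![u + v, w] = f ![u, w] + f ![v, w] := fun u v w => by
    have := f.map_update_add ![u, w] 0 u v
    simpa only [upd0] using this
  have smul_left : ∀ (c : ℂ) u w, f ![c • u, w] = c • f ![u, w] := fun c u w => by
    have := f.map_update_smul ![u, w] 0 c u
    simpa only [upd0] using this
  have self : ∀ u, f ![u, u] = 0 := fun u =>
    f.map_eq_zero_of_eq ![u, u] (i := 0) (j := 1) rfl (by decide)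
  have swap : ∀ u v, f ![u, v] = - f ![v, u] := fun u v => by
    have := self (u + v)
    rw [add_left] at this
    have h1 : ∀ w, f ![w, u + v] = f ![w, u] + f ![w, v] := fun w => by
      have := f.map_update_add ![w, u] 1 u v
      simpa only [upd1] using this
    rw [h1, h1, self, self, zero_add, add_zero] at this
    exact eq_neg_of_add_eq_zero_left this
  -- Antisymmetry brings the sum in the second slot to the first, where additivity has been
  -- established.
  rw [add_left, smul_left, smul_left, swap D₁, swap D₂, add_left, add_left, smul_left, smul_left,
    smul_left, smul_left, self, self, swap D₂ D₁]
  module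

theorem exteriorPower_two_hom_ext {L L' : ⋀[ℂ]^2 T →ₗ[ℂ] N}
    (h : ∀ v w, L (exteriorPower.ιMulti ℂ 2 ![v, w]) = L' (exteriorPower.ιMulti ℂ 2 ![v, w])) :
    L = L' := by
  refine exteriorPower.linearMap_ext ?_
  ext m
  have : m = ![m 0, m 1] := by
    funext j
    fin_cases j <;> rfl
  rw [this]
  exact h _ _

/-- Both sides are linear in `η`, so wedges `v ∧ w` suffice, and there the coefficient is a
determinant. Only the expansion of vectors in `D₁`, `D₂` is needed, not their independence. -/
theorem eq_wedgePairing_smul {a b : Module.Dual ℂ T} {D₁ D₂ : T}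
    (h : ∀ v, v = a v • D₁ + b v • D₂) (η : ⋀[ℂ]^2 T) :
    η = wedgePairing a b η • exteriorPower.ιMulti ℂ 2 ![D₁, D₂] := by
  have : (LinearMap.id : ⋀[ℂ]^2 T →ₗ[ℂ] _) =
      (exteriorPower.pairingDual ℂ T 2 (exteriorPower.ιMulti ℂ 2 ![a, b])).smulRight
        (exteriorPower.ιMulti ℂ 2 ![D₁, D₂]) := by
    refine exteriorPower_two_hom_ext fun v w => ?_
    rw [LinearMap.smulRight_apply]
    change _ = wedgePairing a b _ • _
    rw [wedgePairing_ιMulti]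
    conv_lhs => rw [h v, h w]
    rw [LinearMap.id_apply, alternating_expand]
    congr 1
    ring
  exact LinearMap.congr_fun this η

theorem wedgePairing_comb (a b : Module.Dual ℂ T) (p q r s : ℂ) (η : ⋀[ℂ]^2 T) :
    wedgePairing (p • a + q • b) (r • a + s • b) η = (p * s - q * r) * wedgePairing a b η := by
  rw [wedgePairing, alternating_expand, map_smul]
  rfl

theorem wedgePairing_swap (a b : Module.Dual ℂ T) (η : ⋀[ℂ]^2 T) :
    wedgePairing a b η = -wedgePairing b a η := by
  have := wedgePairing_comb b a 0 1 1 0 η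
  simpa using this

theorem wedgePairing_comb_right (a b c : Module.Dual ℂ T) (p q : ℂ) (η : ⋀[ℂ]^2 T) :
    wedgePairing a (p • b + q • c) η = p * wedgePairing a b η + q * wedgePairing a c η := by
  have : exteriorPower.pairingDual ℂ T 2 (exteriorPower.ιMulti ℂ 2 ![a, p • b + q • c]) =
      p • exteriorPower.pairingDual ℂ T 2 (exteriorPower.ιMulti ℂ 2 ![a, b]) +
      q • exteriorPower.pairingDual ℂ T 2 (exteriorPower.ιMulti ℂ 2 ![a, c]) := by
    refine exteriorPower_two_hom_ext fun v w => ?_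
    simp [Matrix.det_fin_two]
    ring
  exact LinearMap.congr_fun this η

theorem wedgePairing_add_right (a b c : Module.Dual ℂ T) (η : ⋀[ℂ]^2 T) :
    wedgePairing a (b + c) η = wedgePairing a b η + wedgePairing a c η := by
  simpa using wedgePairing_comb_right a b c 1 1 η

theorem wedgePairing_smul_right (a b : Module.Dual ℂ T) (p : ℂ) (η : ⋀[ℂ]^2 T) :
    wedgePairing a (p • b) η = p * wedgePairing a b η := by
  simpa using wedgePairing_comb_right a b 0 p 0 η

theorem wedgePairing_add_left (a b c : Module.Dual ℂ T) (η : ⋀[ℂ]^2 T) :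
    wedgePairing (b + c) a η = wedgePairing b a η + wedgePairing c a η := by
  rw [wedgePairing_swap, wedgePairing_add_right, wedgePairing_swap a b, wedgePairing_swap a c]
  ring

theorem wedgePairing_smul_left (a b : Module.Dual ℂ T) (p : ℂ) (η : ⋀[ℂ]^2 T) :
    wedgePairing (p • b) a η = p * wedgePairing b a η := by
  rw [wedgePairing_swap, wedgePairing_smul_right, wedgePairing_swap a b]
  ring

theorem wedgePairing_add (a b : Module.Dual ℂ T) (η η' : ⋀[ℂ]^2 T) :
    wedgePairing a b (η + η') = wedgePairing a b η + wedgePairing a b η' := map_add _ _ _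

theorem wedgePairing_smul (a b : Module.Dual ℂ T) (c : ℂ) (η : ⋀[ℂ]^2 T) :
    wedgePairing a b (c • η) = c * wedgePairing a b η := map_smul _ _ _

theorem wedgePairing_sum {ι : Type*} (s : Finset ι) (a b : Module.Dual ℂ T) (η : ι → ⋀[ℂ]^2 T) :
    wedgePairing a b (∑ i ∈ s, η i) = ∑ i ∈ s, wedgePairing a b (η i) := map_sum _ _ _

end LinearAlgebra

/-! ### Hadamard's lemma for analytic functions. -/

section Hadamard

variable {V : Type*} [NormedAddCommGroup V] [NormedSpace ℂ V]

/-- Hadamard's lemma: an analytic function is near `x` of the form `g x + L y (y - x)` with `L`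
analytic. -/
theorem exists_analyticAt_eq_add_apply {g : V → ℂ} {x : V} (hg : AnalyticAt ℂ g x) :
    ∃ L : V → V →L[ℂ] ℂ, AnalyticAt ℂ L x ∧ L x = fderiv ℂ g x ∧
      ∀ᶠ y in 𝓝 x, g y = g x + L y (y - x) := by
  -- `p.shift` leaves the last argument of each term of `p` open; its sum is the operator-valued
  -- quotient by `y - x`.
  obtain ⟨p, r, hp⟩ := hg
  have hr : 0 < p.shift.radius := by
    rw [p.radius_shift]
    exact hp.r_pos.trans_le hp.r_le
  have hL0 := (p.shift.hasFPowerSeriesOnBall hr).comp_sub x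
  rw [zero_add] at hL0
  have key : ∀ᶠ y in 𝓝 x, g y = g x + p.shift.sum (y - x) (y - x) := by
    have hu := hL0.unshift (z := g x)
    -- Restoring the constant term to the shifted series gives back `p`, so `g` and `g x + L y (y -
    -- x)` are sums of the same series.
    have hpu : p.shift.unshift (g x) = p := by
      funext n
      cases n with
      | zero =>
        ext v
        simpa [FormalMultilinearSeries.unshift] using (hp.coeff_zero v).symm
      | succ n =>
        exact (continuousMultilinearCurryRightEquiv' ℂ n V ℂ).symm_apply_apply (p n.succ)
    rw [hpu] at hu
    filter_upwards [Metric.eball_mem_nhds x hu.r_pos, Metric.eball_mem_nhds x hp.r_pos]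
      with y hy hy'
    exact (hp.hasSum_sub hy').unique (hu.hasSum_sub hy)
  -- In the product rule for `L y (y - x)`, the term with the derivative of `L` is evaluated at `x -
  -- x = 0`.
  have hd : HasFDerivAt g (p.shift.sum (x - x)) x := by
    have h1 := (hL0.analyticAt.differentiableAt.hasFDerivAt).clm_apply
      ((hasFDerivAt_id x).sub_const x)
    have h2 := (h1.const_add (g x)).congr_of_eventuallyEq key
    exact h2.congr_fderiv (by ext v; simp)
  exact ⟨fun y => p.shift.sum (y - x), hL0.analyticAt, hd.fderiv.symm, key⟩

end Hadamard

/-! ### Coordinate vector fields and differentials of functions. -/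

section Frames

variable {V : Type*} [NormedAddCommGroup V] [NormedSpace ℂ V]
  {M : Type*} [TopologicalSpace M] [ChartedSpace V M] [IsManifold 𝓘(ℂ, V) ω M]

/-- The differential of a function, as a covector. -/
def scalarDiff (f : M → ℂ) (x : M) : TangentSpace 𝓘(ℂ, V) x →L[ℂ] ℂ :=
  mfderiv 𝓘(ℂ, V) 𝓘(ℂ) f x

/-- The derivative of `f` along `Z` is the fibre component of the tangent map of `f` composed with
the section `Z`. -/
theorem IsHolVectorField.scalarDiff_apply {Z : ∀ x : M, TangentSpace 𝓘(ℂ, V) x} {U : Set M}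
    (hU : IsOpen U) (hZ : IsHolVectorField Z U) {f : M → ℂ}
    (hf : ContMDiffOn 𝓘(ℂ, V) 𝓘(ℂ) ω f U) :
    ContMDiffOn 𝓘(ℂ, V) 𝓘(ℂ) ω
      (fun x => scalarDiff f x (Z x)) U := by
  have h1 := (hf.contMDiffOn_tangentMapWithin (m := ω) le_top hU.uniqueMDiffOn).comp hZ
    (fun x hx => hx)
  have h2 := (contMDiff_snd_tangentBundle_modelSpace (n := ω) ℂ 𝓘(ℂ)).comp_contMDiffOn h1
  refine h2.congr fun x hx => ?_
  simp only [Function.comp, tangentMapWithin]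
  rw [mfderivWithin_of_isOpen hU hx]
  rfl

/-- The coordinate vector field in the direction `v` of the chart `e`. -/
def coordField (e : OpenPartialHomeomorph M V) (v : V) (x : M) : TangentSpace 𝓘(ℂ, V) x :=
  (mfderiv 𝓘(ℂ, V) 𝓘(ℂ, V) e.symm (e x) : V →L[ℂ] V) v

variable {e : OpenPartialHomeomorph M V} (he : e ∈ atlas V M)
include he

theorem contMDiffOn_of_mem_atlas : ContMDiffOn 𝓘(ℂ, V) 𝓘(ℂ, V) ω e e.source :=
  contMDiffOn_of_mem_maximalAtlas (IsManifold.subset_maximalAtlas he)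

theorem contMDiffOn_symm_of_mem_atlas : ContMDiffOn 𝓘(ℂ, V) 𝓘(ℂ, V) ω e.symm e.target :=
  contMDiffOn_symm_of_mem_maximalAtlas (IsManifold.subset_maximalAtlas he)

/-- The field is the tangent map of `e.symm` applied to the constant field `v` at `e x`, a composite
of holomorphic maps. -/
theorem isHolVectorField_coordField (v : V) :
    IsHolVectorField (coordField e v) e.source := by
  have h1 := ((contMDiffOn_symm_of_mem_atlas he).contMDiffOn_tangentMapWithin (m := ω) le_top
    e.open_target.uniqueMDiffOn)
  have h2 : ContMDiffOn 𝓘(ℂ, V) 𝓘(ℂ, V).tangent ω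
      (fun x : M => (⟨e x, v⟩ : TangentBundle 𝓘(ℂ, V) V)) e.source := by
    have : ContMDiff 𝓘(ℂ, V) 𝓘(ℂ, V).tangent ω
        (fun x : V => (⟨x, v⟩ : TangentBundle 𝓘(ℂ, V) V)) :=
      contMDiff_vectorSpace_iff_contDiff.2 contDiff_const
    exact this.comp_contMDiffOn (contMDiffOn_of_mem_atlas he)
  refine (h1.comp h2 fun x hx => e.map_source hx).congr fun x hx => ?_
  simp only [Function.comp, tangentMapWithin]
  rw [mfderivWithin_of_isOpen e.open_target (e.map_source hx)]
  -- The base point produced by the composite is `e.symm (e x)`, equal to `x` only propositionally.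
  have : ∀ (x' : M) (w : V), x' = x →
      (⟨x, w⟩ : TangentBundle 𝓘(ℂ, V) M) = ⟨x', w⟩ := by
    rintro _ w rfl
    rfl
  exact this _ _ (e.left_inv hx)

theorem mfderiv_coordField {x : M} (hx : x ∈ e.source) (v : V) :
    (mfderiv 𝓘(ℂ, V) 𝓘(ℂ, V) e x : V →L[ℂ] V) (coordField e v x) = v :=
  ((mdifferentiable_of_mem_atlas he).mfderiv hx).apply_symm_apply v

theorem coordField_mfderiv {x : M} (hx : x ∈ e.source) (u : TangentSpace 𝓘(ℂ, V) x) :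
    coordField e ((mfderiv 𝓘(ℂ, V) 𝓘(ℂ, V) e x : V →L[ℂ] V) u) x = u :=
  ((mdifferentiable_of_mem_atlas he).mfderiv hx).symm_apply_apply u

omit he in
theorem IsHolVectorField.fun_smul {Z : ∀ x : M, TangentSpace 𝓘(ℂ, V) x} {U : Set M}
    (hZ : IsHolVectorField Z U) {f : M → ℂ} (hf : ContMDiffOn 𝓘(ℂ, V) 𝓘(ℂ) ω f U) :
    IsHolVectorField (fun x => f x • Z x) U := ContMDiffOn.smul_section hf hZ

end Frames

/-! ### Bivector fields on a surface through their coefficient in a chart. -/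

section Surface

variable {M : Type*} [TopologicalSpace M] [ChartedSpace (ℂ × ℂ) M] [IsManifold 𝓘(ℂ, ℂ × ℂ) ω M]

/-- The differential of the first coordinate of the chart `e`. -/
def coordForm₁ (e : OpenPartialHomeomorph M (ℂ × ℂ)) (x : M) :
    TangentSpace 𝓘(ℂ, ℂ × ℂ) x →L[ℂ] ℂ :=
  ContinuousLinearMap.fst ℂ ℂ ℂ ∘L
    (mfderiv 𝓘(ℂ, ℂ × ℂ) 𝓘(ℂ, ℂ × ℂ) e x : TangentSpace 𝓘(ℂ, ℂ × ℂ) x →L[ℂ] ℂ × ℂ)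

/-- The differential of the second coordinate of the chart `e`. -/
def coordForm₂ (e : OpenPartialHomeomorph M (ℂ × ℂ)) (x : M) :
    TangentSpace 𝓘(ℂ, ℂ × ℂ) x →L[ℂ] ℂ :=
  ContinuousLinearMap.snd ℂ ℂ ℂ ∘L
    (mfderiv 𝓘(ℂ, ℂ × ℂ) 𝓘(ℂ, ℂ × ℂ) e x : TangentSpace 𝓘(ℂ, ℂ × ℂ) x →L[ℂ] ℂ × ℂ)

/-- The coefficient of a bivector in the chart `e`. -/
def bivCoeff (e : OpenPartialHomeomorph M (ℂ × ℂ)) (x : M)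
    (η : ⋀[ℂ]^2 (TangentSpace 𝓘(ℂ, ℂ × ℂ) x)) : ℂ :=
  wedgePairing (coordForm₁ e x : Module.Dual ℂ (TangentSpace 𝓘(ℂ, ℂ × ℂ) x))
    (coordForm₂ e x : Module.Dual ℂ (TangentSpace 𝓘(ℂ, ℂ × ℂ) x)) η

/-- The bivector `∂₁ ∧ ∂₂` of the chart `e`. -/
def coordBiv (e : OpenPartialHomeomorph M (ℂ × ℂ)) (x : M) :
    ⋀[ℂ]^2 (TangentSpace 𝓘(ℂ, ℂ × ℂ) x) :=
  exteriorPower.ιMulti ℂ 2 ![coordField e ((1, 0) : ℂ × ℂ) x, coordField e ((0, 1) : ℂ × ℂ) x]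

variable {e : OpenPartialHomeomorph M (ℂ × ℂ)} (he : e ∈ atlas (ℂ × ℂ) M)
include he

theorem vector_expand {x : M} (hx : x ∈ e.source) (u : TangentSpace 𝓘(ℂ, ℂ × ℂ) x) :
    u = coordForm₁ e x u • coordField e ((1, 0) : ℂ × ℂ) x +
      coordForm₂ e x u • coordField e ((0, 1) : ℂ × ℂ) x := by
  conv_lhs => rw [← coordField_mfderiv he hx u]
  set w : ℂ × ℂ := (mfderiv 𝓘(ℂ, ℂ × ℂ) 𝓘(ℂ, ℂ × ℂ) e x : (ℂ × ℂ) →L[ℂ] ℂ × ℂ) u with hw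
  have h1 : coordForm₁ e x u = w.1 := rfl
  have h2 : coordForm₂ e x u = w.2 := rfl
  rw [h1, h2]
  have : (w : ℂ × ℂ) = w.1 • ((1, 0) : ℂ × ℂ) + w.2 • ((0, 1) : ℂ × ℂ) := Prod.ext (by simp) (by simp)
  conv_lhs => rw [this]
  simp only [coordField]
  exact ((mfderiv 𝓘(ℂ, ℂ × ℂ) 𝓘(ℂ, ℂ × ℂ) e.symm (e x) : (ℂ × ℂ) →L[ℂ] ℂ × ℂ)).map_add _ _ |>.trans
    (congrArg₂ _ (map_smul _ _ _) (map_smul _ _ _))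

theorem eq_bivCoeff_smul {x : M} (hx : x ∈ e.source)
    (η : ⋀[ℂ]^2 (TangentSpace 𝓘(ℂ, ℂ × ℂ) x)) : η = bivCoeff e x η • coordBiv e x :=
  eq_wedgePairing_smul (vector_expand he hx) η

theorem coordForm₁_coordField {x : M} (hx : x ∈ e.source) (v : ℂ × ℂ) :
    coordForm₁ e x (coordField e v x) = v.1 :=
  congrArg Prod.fst (mfderiv_coordField he hx v)

theorem coordForm₂_coordField {x : M} (hx : x ∈ e.source) (v : ℂ × ℂ) :
    coordForm₂ e x (coordField e v x) = v.2 :=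
  congrArg Prod.snd (mfderiv_coordField he hx v)

theorem bivCoeff_coordBiv {x : M} (hx : x ∈ e.source) : bivCoeff e x (coordBiv e x) = 1 := by
  unfold bivCoeff coordBiv
  rw [wedgePairing_ιMulti]
  simp [coordForm₁_coordField he hx, coordForm₂_coordField he hx]

theorem covector_expand {x : M} (hx : x ∈ e.source) (β : TangentSpace 𝓘(ℂ, ℂ × ℂ) x →L[ℂ] ℂ) :
    β = β (coordField e ((1, 0) : ℂ × ℂ) x) • coordForm₁ e x +
      β (coordField e ((0, 1) : ℂ × ℂ) x) • coordForm₂ e x := by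
  ext u
  conv_lhs => rw [vector_expand he hx u]
  simp [mul_comm]

omit he in
theorem contMDiffOn_wedgePairing {U : Set M} (hU : IsOpen U) {f g : M → ℂ}
    (hf : ContMDiffOn 𝓘(ℂ, ℂ × ℂ) 𝓘(ℂ) ω f U) (hg : ContMDiffOn 𝓘(ℂ, ℂ × ℂ) 𝓘(ℂ) ω g U)
    (η : bivectorFields (ℂ × ℂ) M) :
    ContMDiffOn 𝓘(ℂ, ℂ × ℂ) 𝓘(ℂ) ω (fun x => wedgePairing
      (scalarDiff (V := ℂ × ℂ) f x : Module.Dual ℂ (TangentSpace 𝓘(ℂ, ℂ × ℂ) x))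
      (scalarDiff (V := ℂ × ℂ) g x : Module.Dual ℂ (TangentSpace 𝓘(ℂ, ℂ × ℂ) x)) (η.1 x)) U := by
  intro x hx
  obtain ⟨W, hW, hxW, n, Z, Z', hZ, hZ', hη⟩ := η.2 x
  have key : ContMDiffOn 𝓘(ℂ, ℂ × ℂ) 𝓘(ℂ) ω (fun x => ∑ i,
      (scalarDiff f x (Z i x) * scalarDiff g x (Z' i x) -
        scalarDiff f x (Z' i x) * scalarDiff g x (Z i x))) (U ∩ W) := by
    have ho := hU.inter hW
    have hf' := hf.mono (Set.inter_subset_left (t := W))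
    have hg' := hg.mono (Set.inter_subset_left (t := W))
    refine contMDiffOn_finsetSum fun i _ => ?_
    have a := (hZ i).mono (Set.inter_subset_right (s := U))
    have b := (hZ' i).mono (Set.inter_subset_right (s := U))
    exact ((a.scalarDiff_apply ho hf').mul (b.scalarDiff_apply ho hg')).sub
      ((b.scalarDiff_apply ho hf').mul (a.scalarDiff_apply ho hg'))
  have key' := key.congr (f₁ := fun x => wedgePairing
      (scalarDiff (V := ℂ × ℂ) f x : Module.Dual ℂ (TangentSpace 𝓘(ℂ, ℂ × ℂ) x))
      (scalarDiff (V := ℂ × ℂ) g x : Module.Dual ℂ (TangentSpace 𝓘(ℂ, ℂ × ℂ) x)) (η.1 x)) (fun y hy => by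
    rw [hη y hy.2, wedgePairing_sum]
    exact Finset.sum_congr rfl fun i _ => wedgePairing_ιMulti _ _ _ _)
  exact (key'.contMDiffAt ((hU.inter hW).mem_nhds ⟨hx, hxW⟩)).contMDiffWithinAt

theorem scalarDiff_fst {x : M} (hx : x ∈ e.source) :
    scalarDiff (fun x => (e x).1) x = coordForm₁ e x := by
  have h1 : HasMFDerivAt 𝓘(ℂ, ℂ × ℂ) 𝓘(ℂ) (Prod.fst : ℂ × ℂ → ℂ) (e x)
      (ContinuousLinearMap.fst ℂ ℂ ℂ) := hasFDerivAt_fst.hasMFDerivAt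
  exact (h1.comp x ((mdifferentiable_of_mem_atlas he).mdifferentiableAt hx).hasMFDerivAt).mfderiv

theorem scalarDiff_snd {x : M} (hx : x ∈ e.source) :
    scalarDiff (fun x => (e x).2) x = coordForm₂ e x := by
  have h1 : HasMFDerivAt 𝓘(ℂ, ℂ × ℂ) 𝓘(ℂ) (Prod.snd : ℂ × ℂ → ℂ) (e x)
      (ContinuousLinearMap.snd ℂ ℂ ℂ) := hasFDerivAt_snd.hasMFDerivAt
  exact (h1.comp x ((mdifferentiable_of_mem_atlas he).mdifferentiableAt hx).hasMFDerivAt).mfderiv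

theorem contMDiffOn_fst_chart :
    ContMDiffOn 𝓘(ℂ, ℂ × ℂ) 𝓘(ℂ) ω (fun x => (e x).1) e.source :=
  (contDiff_fst.contMDiff (n := ω)).comp_contMDiffOn (contMDiffOn_of_mem_atlas he)

theorem contMDiffOn_snd_chart :
    ContMDiffOn 𝓘(ℂ, ℂ × ℂ) 𝓘(ℂ) ω (fun x => (e x).2) e.source :=
  (contDiff_snd.contMDiff (n := ω)).comp_contMDiffOn (contMDiffOn_of_mem_atlas he)

theorem contMDiffOn_bivCoeff (η : bivectorFields (ℂ × ℂ) M) :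
    ContMDiffOn 𝓘(ℂ, ℂ × ℂ) 𝓘(ℂ) ω (fun x => bivCoeff e x (η.1 x)) e.source := by
  refine (contMDiffOn_wedgePairing e.open_source (contMDiffOn_fst_chart he)
    (contMDiffOn_snd_chart he) η).congr fun x hx => ?_
  rw [scalarDiff_fst he hx, scalarDiff_snd he hx]
  rfl

omit he in
-- On a surface a bivector is its coefficient `c` times `∂₁ ∧ ∂₂`, hence the single wedge `(c ∂₁) ∧
-- ∂₂`.
theorem mem_bivectorFields {η : ∀ x : M, ⋀[ℂ]^2 (TangentSpace 𝓘(ℂ, ℂ × ℂ) x)}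
    (h : ∀ x₀ : M, ∃ e ∈ atlas (ℂ × ℂ) M, x₀ ∈ e.source ∧
      ContMDiffOn 𝓘(ℂ, ℂ × ℂ) 𝓘(ℂ) ω (fun x => bivCoeff e x (η x)) e.source) :
    η ∈ bivectorFields (ℂ × ℂ) M := by
  intro x₀
  obtain ⟨e, he, hx, hh⟩ := h x₀
  refine ⟨e.source, e.open_source, hx, 1,
    fun _ x => bivCoeff e x (η x) • coordField e ((1, 0) : ℂ × ℂ) x,
    fun _ x => coordField e ((0, 1) : ℂ × ℂ) x,
    fun _ => (isHolVectorField_coordField he _).fun_smul hh,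
    fun _ => isHolVectorField_coordField he _, fun x hx => ?_⟩
  rw [Finset.univ_unique, Finset.sum_singleton]
  conv_lhs => rw [eq_bivCoeff_smul he hx (η x)]
  have := alternating_expand (exteriorPower.ιMulti ℂ 2 (M := TangentSpace 𝓘(ℂ, ℂ × ℂ) x))
    (coordField e ((1, 0) : ℂ × ℂ) x) (coordField e ((0, 1) : ℂ × ℂ) x)
    (bivCoeff e x (η x)) 0 0 1
  simpa [coordBiv] using this.symm

end Surface

/-! ### Differentials and point derivations of holomorphic functions. -/

section HolFunctions

variable {V : Type*} [NormedAddCommGroup V] [NormedSpace ℂ V]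
  {M : Type*} [TopologicalSpace M] [ChartedSpace V M]

/-- The holomorphic function on `U` defined by a function on `M` that is holomorphic on `U`. -/
def Hol.ofOn {U : Opens M} (F : M → ℂ) (hF : ContMDiffOn 𝓘(ℂ, V) 𝓘(ℂ) ω F U) : Hol V U :=
  ⟨fun x => F x, fun x => contMDiffAt_subtype_iff.2 (hF.contMDiffAt (U.2.mem_nhds x.2))⟩

theorem Hol.res_apply {U W : Opens M} (h : W ≤ U) (f : Hol V U) (x : W) :
    f.res h x = f ⟨x.1, h x.2⟩ := rfl

theorem Hol.extend_apply {U : Opens M} (f : Hol V U) (x : U) :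
    Function.extend Subtype.val (f : U → ℂ) 0 x.1 = f x :=
  Subtype.val_injective.extend_apply _ _ _

theorem Hol.contMDiffOn_extend {U : Opens M} (f : Hol V U) :
    ContMDiffOn 𝓘(ℂ, V) 𝓘(ℂ) ω (Function.extend Subtype.val (f : U → ℂ) 0) U := by
  intro x hx
  refine ContMDiffAt.contMDiffWithinAt ?_
  have h : ContMDiffAt 𝓘(ℂ, V) 𝓘(ℂ) ω
      (fun y : U => Function.extend Subtype.val (f : U → ℂ) 0 y.1) ⟨x, hx⟩ :=
    (f.contMDiff ⟨x, hx⟩).congr_of_eventuallyEq (.of_forall fun y => f.extend_apply y)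
  exact contMDiffAt_subtype_iff.1 h

/-- Makes the extension by zero irrelevant: any other function agreeing with `f` on `U` computes the
differential. -/
theorem Hol.d_eq {U : Opens M} (f : Hol V U) {F : M → ℂ} (h : ∀ y : U, f y = F y) {x : M}
    (hx : x ∈ U) : f.d x = scalarDiff F x := by
  refine Filter.EventuallyEq.mfderiv_eq ?_
  filter_upwards [U.2.mem_nhds hx] with y hy
  rw [← h ⟨y, hy⟩]
  exact f.extend_apply ⟨y, hy⟩

theorem Hol.hasMFDerivAt {U : Opens M} (f : Hol V U) {x : M} (hx : x ∈ U) :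
    HasMFDerivAt 𝓘(ℂ, V) 𝓘(ℂ) (Function.extend Subtype.val (f : U → ℂ) 0) x (f.d x) :=
  ((f.contMDiffOn_extend.contMDiffAt (U.2.mem_nhds hx)).mdifferentiableAt
    (by simp)).hasMFDerivAt

theorem Hol.d_res {U W : Opens M} (h : W ≤ U) (f : Hol V U) {x : M} (hx : x ∈ W) :
    (f.res h).d x = f.d x := by
  refine Hol.d_eq _ (fun y => ?_) hx
  rw [Hol.res_apply]
  exact (f.extend_apply ⟨y.1, h y.2⟩).symm

theorem Hol.d_add {U : Opens M} (f g : Hol V U) {x : M} (hx : x ∈ U) :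
    (f + g).d x = f.d x + g.d x := by
  rw [Hol.d_eq (f + g) (F := Function.extend Subtype.val (f : U → ℂ) 0 +
    Function.extend Subtype.val (g : U → ℂ) 0) (fun y => ?_) hx]
  · exact ((f.hasMFDerivAt hx).add (g.hasMFDerivAt hx)).mfderiv
  · rw [Pi.add_apply, f.extend_apply, g.extend_apply]
    rfl

theorem Hol.d_smul {U : Opens M} (c : ℂ) (f : Hol V U) {x : M} (hx : x ∈ U) :
    (c • f).d x = c • f.d x := by
  rw [Hol.d_eq (c • f) (F := c • Function.extend Subtype.val (f : U → ℂ) 0) (fun y => ?_) hx]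
  · exact ((f.hasMFDerivAt hx).const_smul c).mfderiv
  · rw [Pi.smul_apply, f.extend_apply]
    rfl

theorem Hol.d_mul {U : Opens M} (f g : Hol V U) {x : M} (hx : x ∈ U) :
    (f * g).d x = f ⟨x, hx⟩ • g.d x + g ⟨x, hx⟩ • f.d x := by
  rw [Hol.d_eq (f * g) (F := Function.extend Subtype.val (f : U → ℂ) 0 *
    Function.extend Subtype.val (g : U → ℂ) 0) (fun y => ?_) hx]
  · have := ((f.hasMFDerivAt hx).mul (g.hasMFDerivAt hx)).mfderiv
    rw [f.extend_apply ⟨x, hx⟩, g.extend_apply ⟨x, hx⟩] at this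
    exact this
  · rw [Pi.mul_apply, f.extend_apply, g.extend_apply]
    rfl

theorem Hol.d_ofOn {U : Opens M} (F : M → ℂ) (hF : ContMDiffOn 𝓘(ℂ, V) 𝓘(ℂ) ω F U) {x : M}
    (hx : x ∈ U) : (Hol.ofOn F hF).d x = scalarDiff F x := Hol.d_eq _ (fun _ => rfl) hx

/-- A `ℂ`-valued derivation at `x` of the sheaf of holomorphic functions on `U`. -/
structure PointDerivation (U : Opens M) (x : M) where
  /-- the value on functions on a neighbourhood `W ⊆ U` of `x` -/
  app : ∀ W : Opens M, W ≤ U → x ∈ W → (Hol V W →ₗ[ℂ] ℂ)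
  app_res : ∀ (W W' : Opens M) (hW : W ≤ U) (h : W' ≤ W) (hx : x ∈ W') (f : Hol V W),
    app W' (h.trans hW) hx (f.res h) = app W hW (h hx) f
  app_mul : ∀ (W : Opens M) (hW : W ≤ U) (hx : x ∈ W) (f g : Hol V W),
    app W hW hx (f * g) = app W hW hx f * g ⟨x, hx⟩ + f ⟨x, hx⟩ * app W hW hx g

end HolFunctions

section Surface

variable {M : Type*} [TopologicalSpace M] [ChartedSpace (ℂ × ℂ) M] [IsManifold 𝓘(ℂ, ℂ × ℂ) ω M]

/-- By Hadamard's lemma, `g = g(x) + (s - s(x)) g₁ + (z - z(x)) g₂` near `x`, and `g₁`, `g₂` vanish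
at `x` because `dg` does. The Leibniz rule kills constants and products of two functions vanishing
at `x`. The factors exist only on a smaller neighbourhood `W`, which is why a point derivation is
given on all neighbourhoods inside `U`. -/
theorem PointDerivation.app_eq_zero {U : Opens M} {x : M} (δ : PointDerivation (V := ℂ × ℂ) U x)
    (hx : x ∈ U) (g : Hol (ℂ × ℂ) U) (hg : g.d x = 0) : δ.app U le_rfl hx g = 0 := by
  set G := Function.extend Subtype.val (g : U → ℂ) 0 with hG
  set e := chartAt (ℂ × ℂ) x with he
  have hxe : x ∈ e.source := mem_chart_source _ x
  have hea : e ∈ atlas (ℂ × ℂ) M := chart_mem_atlas _ x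
  have hxt : e x ∈ e.target := e.map_source hxe
  have hsymm : ContMDiffAt 𝓘(ℂ, ℂ × ℂ) 𝓘(ℂ, ℂ × ℂ) ω e.symm (e x) :=
    (contMDiffOn_symm_of_mem_atlas hea).contMDiffAt (e.open_target.mem_nhds hxt)
  have hGx : ContMDiffAt 𝓘(ℂ, ℂ × ℂ) 𝓘(ℂ) ω G (e.symm (e x)) := by
    rw [e.left_inv hxe]
    exact g.contMDiffOn_extend.contMDiffAt (U.2.mem_nhds hx)
  have han : AnalyticAt ℂ (G ∘ e.symm) (e x) :=
    (hGx.comp (e x) hsymm).contDiffAt.analyticAt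
  obtain ⟨L, hL, hLx, hLe⟩ := exists_analyticAt_eq_add_apply han
  -- `L (e x)` is the differential of `g` at `x` read in the chart.
  have hL0 : L (e x) = 0 := by
    rw [hLx, ← mfderiv_eq_fderiv, mfderiv_comp (I' := 𝓘(ℂ, ℂ × ℂ)) (e x)
      (hGx.mdifferentiableAt (by simp)) (hsymm.mdifferentiableAt (by simp))]
    have : mfderiv 𝓘(ℂ, ℂ × ℂ) 𝓘(ℂ) G (e.symm (e x)) = 0 := by
      rw [e.left_inv hxe]
      exact hg
    rw [this]
    exact ContinuousLinearMap.zero_comp _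
  obtain ⟨O, hO, hOo, hxO⟩ := eventually_nhds_iff.1 (hLe.and hL.eventually_analyticAt)
  let W : Opens M := ⟨(e.source ∩ e ⁻¹' O) ∩ U, (e.isOpen_inter_preimage hOo).inter U.2⟩
  have hWU : W ≤ U := fun y hy => hy.2
  have hxW : x ∈ W := ⟨⟨hxe, hxO⟩, hx⟩
  have hWe : (W : Set M) ⊆ e.source := fun y hy => hy.1.1
  have hLW : ∀ v : ℂ × ℂ, ContMDiffOn 𝓘(ℂ, ℂ × ℂ) 𝓘(ℂ) ω (fun y => L (e y) v) W := by
    intro v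
    have h1 : ContMDiffOn 𝓘(ℂ, ℂ × ℂ) 𝓘(ℂ) ω (fun p => L p v) O := by
      intro p hp
      have : AnalyticAt ℂ (fun p => L p v) p :=
        ((ContinuousLinearMap.apply ℂ ℂ v).analyticAt _).comp (hO p hp).2
      exact this.contDiffAt.contMDiffAt.contMDiffWithinAt
    exact h1.comp ((contMDiffOn_of_mem_atlas hea).mono hWe) fun y hy => hy.1.2
  let g₁ : Hol (ℂ × ℂ) W := Hol.ofOn _ (hLW (1, 0))
  let g₂ : Hol (ℂ × ℂ) W := Hol.ofOn _ (hLW (0, 1))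
  let s : Hol (ℂ × ℂ) W := Hol.ofOn _ ((contMDiffOn_fst_chart hea).mono hWe)
  let z : Hol (ℂ × ℂ) W := Hol.ofOn _ ((contMDiffOn_snd_chart hea).mono hWe)
  -- The Leibniz rule for `1 * 1` gives `δ 1 = δ 1 + δ 1`.
  have h1 : δ.app W hWU hxW 1 = 0 := by
    have := δ.app_mul W hWU hxW 1 1
    rw [mul_one] at this
    change _ = _ * (1 : ℂ) + (1 : ℂ) * _ at this
    rw [mul_one, one_mul] at this
    exact left_eq_add.1 this
  have hdec : g.res hWU = g ⟨x, hx⟩ • 1 + (s - (e x).1 • 1) * g₁ + (z - (e x).2 • 1) * g₂ := by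
    ext y
    have hy := (hO (e y.1) y.2.1.2).1
    simp only [Function.comp] at hy
    rw [e.left_inv hxe, e.left_inv y.2.1.1, hG, g.extend_apply ⟨x, hx⟩,
      g.extend_apply ⟨y.1, y.2.2⟩] at hy
    change g ⟨y.1, y.2.2⟩ = g ⟨x, hx⟩ * 1 + ((e y.1).1 - (e x).1 * 1) * L (e y.1) (1, 0) +
      ((e y.1).2 - (e x).2 * 1) * L (e y.1) (0, 1)
    rw [hy]
    have : e y.1 - e x = ((e y.1).1 - (e x).1) • ((1, 0) : ℂ × ℂ) +
      ((e y.1).2 - (e x).2) • ((0, 1) : ℂ × ℂ) := Prod.ext (by simp) (by simp)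
    rw [this, map_add, map_smul, map_smul]
    simp only [smul_eq_mul]
    ring
  rw [← δ.app_res U W le_rfl hWU hxW g, hdec, map_add, map_add, map_smul, h1, δ.app_mul, δ.app_mul]
  have e1 : g₁ ⟨x, hxW⟩ = 0 := by
    change L (e x) (1, 0) = 0
    rw [hL0]; rfl
  have e2 : g₂ ⟨x, hxW⟩ = 0 := by
    change L (e x) (0, 1) = 0
    rw [hL0]; rfl
  have e3 : (s - (e x).1 • 1) ⟨x, hxW⟩ = 0 := by
    change (e x).1 - (e x).1 * 1 = 0
    ring
  have e4 : (z - (e x).2 • 1) ⟨x, hxW⟩ = 0 := by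
    change (e x).2 - (e x).2 * 1 = 0
    ring
  rw [e1, e2, e3, e4]
  simp

end Surface

/-! ### Skew biderivations and their Jacobiator. -/

section Biderivation

variable (V : Type*) [NormedAddCommGroup V] [NormedSpace ℂ V]
  (M : Type*) [TopologicalSpace M] [ChartedSpace V M]

/-- A Poisson structure without the Jacobi identity. -/
structure SkewBiderivation where
  /-- the bracket of holomorphic functions on an open set -/
  bracket : ∀ U : Opens M, Hol V U →ₗ[ℂ] Hol V U →ₗ[ℂ] Hol V U
  bracket_res : ∀ (U W : Opens M) (h : W ≤ U) (f g : Hol V U),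
    (bracket U f g).res h = bracket W (f.res h) (g.res h)
  skew : ∀ (U : Opens M) (f g : Hol V U), bracket U f g = -bracket U g f
  leibniz : ∀ (U : Opens M) (f g h : Hol V U),
    bracket U f (g * h) = bracket U f g * h + g * bracket U f h

variable {V M}

/-- The biderivation underlying a Poisson structure. -/
def PoissonStructure.toSkewBiderivation (P : PoissonStructure V M) : SkewBiderivation V M :=
  ⟨P.bracket, P.bracket_res, P.skew, P.leibniz⟩

namespace SkewBiderivation

variable (B : SkewBiderivation V M)

/-- The derivation `k ↦ {f, k}(x)`. -/
def pointDerivation {U : Opens M} (f : Hol V U) (x : M) : PointDerivation (V := V) U x where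
  app W hW hx :=
    { toFun := fun k => B.bracket W (f.res hW) k ⟨x, hx⟩
      map_add' := fun k k' => by
        rw [map_add]
        rfl
      map_smul' := fun c k => by
        rw [map_smul]
        rfl }
  app_res W W' hW h hx k := by
    change B.bracket W' (Hol.res h (f.res hW)) (k.res h) ⟨x, hx⟩ = _
    rw [← B.bracket_res]
    rfl
  app_mul W hW hx k k' := by
    change B.bracket W (f.res hW) (k * k') ⟨x, hx⟩ = _
    rw [B.leibniz]
    rfl

/-- The Jacobiator of a bracket. -/
def jacobiator (U : Opens M) (f g h : Hol V U) : Hol V U :=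
  B.bracket U f (B.bracket U g h) + B.bracket U g (B.bracket U h f) +
    B.bracket U h (B.bracket U f g)

theorem jacobiator_cyclic (U : Opens M) (f g h : Hol V U) :
    B.jacobiator U f g h = B.jacobiator U g h f := by
  unfold jacobiator
  abel

theorem jacobiator_res {U W : Opens M} (hW : W ≤ U) (f g h : Hol V U) :
    (B.jacobiator U f g h).res hW = B.jacobiator W (f.res hW) (g.res hW) (h.res hW) := by
  unfold jacobiator
  simp only [← B.bracket_res]
  rfl

/-- Expanding by the Leibniz rule leaves mixed products such as `{g, h}{f, k}`, which cancel in
pairs. -/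
theorem jacobiator_mul (U : Opens M) (f g h k : Hol V U) :
    B.jacobiator U f g (h * k) = B.jacobiator U f g h * k + h * B.jacobiator U f g k := by
  unfold jacobiator
  -- Skew-symmetry puts `h * k` in the second slot of every bracket, where the Leibniz rule applies.
  simp only [B.skew U _ f, B.skew U (h * k), B.skew U h (B.bracket U f g),
    B.skew U k (B.bracket U f g), map_neg, B.leibniz, map_add]
  ring

theorem jacobiator_add (U : Opens M) (f g h k : Hol V U) :
    B.jacobiator U f g (h + k) = B.jacobiator U f g h + B.jacobiator U f g k := by
  unfold jacobiator
  simp only [map_add, LinearMap.add_apply]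
  abel

theorem jacobiator_smul (U : Opens M) (f g h : Hol V U) (c : ℂ) :
    B.jacobiator U f g (c • h) = c • B.jacobiator U f g h := by
  unfold jacobiator
  simp only [map_smul, LinearMap.smul_apply, smul_add]

/-- The derivation `k ↦ J(f, g, k)(x)`, `J` the Jacobiator. -/
def jacobiatorDerivation {U : Opens M} (f g : Hol V U) (x : M) :
    PointDerivation (V := V) U x where
  app W hW hx :=
    { toFun := fun k => B.jacobiator W (f.res hW) (g.res hW) k ⟨x, hx⟩
      map_add' := fun k k' => by
        rw [jacobiator_add]
        rfl
      map_smul' := fun c k => by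
        rw [jacobiator_smul]
        rfl }
  app_res W W' hW h hx k := by
    change B.jacobiator W' (Hol.res h (f.res hW)) (Hol.res h (g.res hW)) (k.res h) ⟨x, hx⟩ = _
    rw [← B.jacobiator_res]
    rfl
  app_mul W hW hx k k' := by
    change B.jacobiator W (f.res hW) (g.res hW) (k * k') ⟨x, hx⟩ = _
    rw [B.jacobiator_mul]
    rfl

end SkewBiderivation

end Biderivation

/-! ### Poisson structures on a surface are bivector fields. -/

section Surface

variable {M : Type*} [TopologicalSpace M] [ChartedSpace (ℂ × ℂ) M] [IsManifold 𝓘(ℂ, ℂ × ℂ) ω M]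

namespace SkewBiderivation

variable (B : SkewBiderivation (ℂ × ℂ) M)

theorem bracket_eq_zero_right {U : Opens M} {x : M} (hx : x ∈ U) (f g : Hol (ℂ × ℂ) U)
    (hg : g.d x = 0) : B.bracket U f g ⟨x, hx⟩ = 0 :=
  (B.pointDerivation f x).app_eq_zero hx g hg

/-- Allows functions to be replaced at `x` by linear combinations of coordinates. The difference of
two functions with equal differentials is killed in the second slot, and skew-symmetry transfers
this to the first. -/
theorem bracket_congr {U : Opens M} {x : M} (hx : x ∈ U) {f f' g g' : Hol (ℂ × ℂ) U}
    (hf : f.d x = f'.d x) (hg : g.d x = g'.d x) :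
    B.bracket U f g ⟨x, hx⟩ = B.bracket U f' g' ⟨x, hx⟩ := by
  have sub : ∀ h h' : Hol (ℂ × ℂ) U, h.d x = h'.d x → (h + (-1 : ℂ) • h').d x = 0 := by
    intro h h' hh
    rw [Hol.d_add _ _ hx, Hol.d_smul _ _ hx, hh]
    module
  have right : ∀ k h h' : Hol (ℂ × ℂ) U, h.d x = h'.d x →
      B.bracket U k h ⟨x, hx⟩ = B.bracket U k h' ⟨x, hx⟩ := by
    intro k h h' hh
    have := B.bracket_eq_zero_right hx k _ (sub h h' hh)
    rw [map_add, map_smul] at this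
    change B.bracket U k h ⟨x, hx⟩ + (-1 : ℂ) * B.bracket U k h' ⟨x, hx⟩ = 0 at this
    linear_combination this
  rw [right f g g' hg, B.skew, B.skew U f' g']
  exact congrArg Neg.neg (right g' f f' hf)

/-- The Jacobiator is a derivation in its last slot; cyclic symmetry gives the other two. -/
theorem jacobiator_congr {U : Opens M} {x : M} (hx : x ∈ U) {f f' g g' k k' : Hol (ℂ × ℂ) U}
    (hf : f.d x = f'.d x) (hg : g.d x = g'.d x) (hk : k.d x = k'.d x) :
    B.jacobiator U f g k ⟨x, hx⟩ = B.jacobiator U f' g' k' ⟨x, hx⟩ := by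
  have right : ∀ a b h h' : Hol (ℂ × ℂ) U, h.d x = h'.d x →
      B.jacobiator U a b h ⟨x, hx⟩ = B.jacobiator U a b h' ⟨x, hx⟩ := by
    intro a b h h' hh
    have h0 : (h + (-1 : ℂ) • h').d x = 0 := by
      rw [Hol.d_add _ _ hx, Hol.d_smul _ _ hx, hh]
      module
    have : B.jacobiator U a b (h + (-1 : ℂ) • h') ⟨x, hx⟩ = 0 :=
      (B.jacobiatorDerivation a b x).app_eq_zero hx _ h0
    rw [jacobiator_add, jacobiator_smul] at this
    change B.jacobiator U a b h ⟨x, hx⟩ + (-1 : ℂ) * B.jacobiator U a b h' ⟨x, hx⟩ = 0 at this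
    linear_combination this
  rw [right f g k k' hk, B.jacobiator_cyclic, right g k' f f' hf, B.jacobiator_cyclic,
    right k' f' g g' hg, B.jacobiator_cyclic]

/-- An alternating trilinear expression vanishes on a plane: everything reduces to `{s, {s, z}}` and
`{z, {s, z}}`, whose coefficients cancel. -/
theorem jacobiator_comb (U : Opens M) (s z : Hol (ℂ × ℂ) U) (a b a' b' a'' b'' : ℂ) :
    B.jacobiator U (a • s + b • z) (a' • s + b' • z) (a'' • s + b'' • z) = 0 := by
  have self : ∀ f, B.bracket U f f = 0 := fun f => by
    have h := B.skew U f f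
    have h2 : (2 : ℂ) • B.bracket U f f = 0 := by
      rw [two_smul]
      exact add_eq_zero_iff_eq_neg.2 h
    exact (smul_eq_zero.1 h2).resolve_left two_ne_zero
  unfold jacobiator
  simp only [map_add, map_smul, LinearMap.add_apply, LinearMap.smul_apply, self, B.skew U z s,
    smul_zero, add_zero, zero_add, smul_neg, map_neg]
  module

/-- A skew-symmetric biderivation on a complex surface satisfies the Jacobi identity. -/
theorem jacobiator_eq_zero (U : Opens M) (f g h : Hol (ℂ × ℂ) U) : B.jacobiator U f g h = 0 := by
  ext ⟨x, hx⟩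
  have hea : chartAt (ℂ × ℂ) x ∈ atlas (ℂ × ℂ) M := chart_mem_atlas _ x
  have hxe : x ∈ (chartAt (ℂ × ℂ) x).source := mem_chart_source _ x
  set e := chartAt (ℂ × ℂ) x with he
  let W : Opens M := ⟨e.source ∩ U, e.open_source.inter U.2⟩
  have hWU : W ≤ U := fun y hy => hy.2
  have hxW : x ∈ W := ⟨hxe, hx⟩
  have hWe : (W : Set M) ⊆ e.source := fun y hy => hy.1
  let s : Hol (ℂ × ℂ) W := Hol.ofOn _ ((contMDiffOn_fst_chart hea).mono hWe)
  let z : Hol (ℂ × ℂ) W := Hol.ofOn _ ((contMDiffOn_snd_chart hea).mono hWe)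
  -- At the single point `x`, every function has the differential of a combination of the
  -- coordinates with constant coefficients.
  have key : ∀ k : Hol (ℂ × ℂ) U, (k.res hWU).d x = ((k.d x (coordField e ((1, 0) : ℂ × ℂ) x)) • s +
      (k.d x (coordField e ((0, 1) : ℂ × ℂ) x)) • z).d x := by
    intro k
    rw [Hol.d_add _ _ hxW, Hol.d_smul _ _ hxW, Hol.d_smul _ _ hxW, Hol.d_res _ _ hxW,
      Hol.d_ofOn _ _ hxW, Hol.d_ofOn _ _ hxW, scalarDiff_fst hea hxe, scalarDiff_snd hea hxe]
    exact covector_expand hea hxe _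
  change (B.jacobiator U f g h).res hWU ⟨x, hxW⟩ = 0
  rw [B.jacobiator_res, B.jacobiator_congr hxW (key f) (key g) (key h), B.jacobiator_comb]
  rfl

/-- The biderivation of a bivector field. -/
def ofBivector (η : bivectorFields (ℂ × ℂ) M) : SkewBiderivation (ℂ × ℂ) M where
  bracket U := LinearMap.mk₂ ℂ
    (fun f g => Hol.ofOn _ (contMDiffOn_wedgePairing U.2 f.contMDiffOn_extend
      g.contMDiffOn_extend η))
    (fun f f' g => by
      ext x
      refine Eq.trans ?_ (wedgePairing_add_left
        (g.d x.1 : Module.Dual ℂ (TangentSpace 𝓘(ℂ, ℂ × ℂ) x.1)) (f.d x.1) (f'.d x.1) _)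
      change wedgePairing ((f + f').d x.1 : Module.Dual ℂ (TangentSpace 𝓘(ℂ, ℂ × ℂ) x.1)) _ _ = _
      rw [Hol.d_add _ _ x.2]
      rfl)
    (fun c f g => by
      ext x
      refine Eq.trans ?_ (wedgePairing_smul_left
        (g.d x.1 : Module.Dual ℂ (TangentSpace 𝓘(ℂ, ℂ × ℂ) x.1)) (f.d x.1) c _)
      change wedgePairing ((c • f).d x.1 : Module.Dual ℂ (TangentSpace 𝓘(ℂ, ℂ × ℂ) x.1)) _ _ = _
      rw [Hol.d_smul _ _ x.2]
      rfl)
    (fun f g g' => by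
      ext x
      refine Eq.trans ?_ (wedgePairing_add_right
        (f.d x.1 : Module.Dual ℂ (TangentSpace 𝓘(ℂ, ℂ × ℂ) x.1)) (g.d x.1) (g'.d x.1) _)
      change wedgePairing _ ((g + g').d x.1 : Module.Dual ℂ (TangentSpace 𝓘(ℂ, ℂ × ℂ) x.1)) _ = _
      rw [Hol.d_add _ _ x.2]
      rfl)
    (fun c f g => by
      ext x
      refine Eq.trans ?_ (wedgePairing_smul_right
        (f.d x.1 : Module.Dual ℂ (TangentSpace 𝓘(ℂ, ℂ × ℂ) x.1)) (g.d x.1) c _)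
      change wedgePairing _ ((c • g).d x.1 : Module.Dual ℂ (TangentSpace 𝓘(ℂ, ℂ × ℂ) x.1)) _ = _
      rw [Hol.d_smul _ _ x.2]
      rfl)
  bracket_res U W h f g := by
    ext x
    change wedgePairing (f.d x.1 : Module.Dual ℂ (TangentSpace 𝓘(ℂ, ℂ × ℂ) x.1))
      (g.d x.1 : Module.Dual ℂ (TangentSpace 𝓘(ℂ, ℂ × ℂ) x.1)) _ =
      wedgePairing ((f.res h).d x.1 : Module.Dual ℂ (TangentSpace 𝓘(ℂ, ℂ × ℂ) x.1))
      ((g.res h).d x.1 : Module.Dual ℂ (TangentSpace 𝓘(ℂ, ℂ × ℂ) x.1)) _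
    rw [Hol.d_res _ _ x.2, Hol.d_res _ _ x.2]
  skew U f g := by
    ext x
    exact wedgePairing_swap _ _ _
  leibniz U f g h := by
    ext x
    change wedgePairing (f.d x.1 : Module.Dual ℂ (TangentSpace 𝓘(ℂ, ℂ × ℂ) x.1))
      ((g * h).d x.1 : Module.Dual ℂ (TangentSpace 𝓘(ℂ, ℂ × ℂ) x.1)) _ =
      wedgePairing (f.d x.1 : Module.Dual ℂ (TangentSpace 𝓘(ℂ, ℂ × ℂ) x.1))
        (g.d x.1 : Module.Dual ℂ (TangentSpace 𝓘(ℂ, ℂ × ℂ) x.1)) _ * h x +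
      g x * wedgePairing (f.d x.1 : Module.Dual ℂ (TangentSpace 𝓘(ℂ, ℂ × ℂ) x.1))
        (h.d x.1 : Module.Dual ℂ (TangentSpace 𝓘(ℂ, ℂ × ℂ) x.1)) _
    rw [Hol.d_mul _ _ x.2]
    refine (wedgePairing_comb_right (f.d x.1 : Module.Dual ℂ (TangentSpace 𝓘(ℂ, ℂ × ℂ) x.1))
      (h.d x.1) (g.d x.1) _ _ _).trans ?_
    ring

end SkewBiderivation

theorem exists_poisson_encodedBy (η : bivectorFields (ℂ × ℂ) M) :
    ∃ P : PoissonStructure (ℂ × ℂ) M, P.EncodedBy η :=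
  ⟨{ SkewBiderivation.ofBivector η with
      jacobi := (SkewBiderivation.ofBivector η).jacobiator_eq_zero }, fun _ _ _ _ => rfl⟩

theorem PoissonStructure.EncodedBy.eq {P P' : PoissonStructure (ℂ × ℂ) M}
    {η : bivectorFields (ℂ × ℂ) M} (h : P.EncodedBy η) (h' : P'.EncodedBy η) : P = P' := by
  ext U f g x
  rw [h, h']

/-- The coefficient of an encoding bivector in a chart is forced to be the bracket of the two
coordinate functions. -/
theorem PoissonStructure.EncodedBy.eq_bivector {P : PoissonStructure (ℂ × ℂ) M}
    {η η' : bivectorFields (ℂ × ℂ) M} (h : P.EncodedBy η) (h' : P.EncodedBy η') : η = η' := by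
  refine Subtype.ext (funext fun x => ?_)
  have hea : chartAt (ℂ × ℂ) x ∈ atlas (ℂ × ℂ) M := chart_mem_atlas _ x
  have hxe : x ∈ (chartAt (ℂ × ℂ) x).source := mem_chart_source _ x
  let W : Opens M := ⟨_, (chartAt (ℂ × ℂ) x).open_source⟩
  have key : ∀ η : bivectorFields (ℂ × ℂ) M, P.EncodedBy η →
      bivCoeff (chartAt (ℂ × ℂ) x) x (η.1 x) =
        P.bracket W (Hol.ofOn _ (contMDiffOn_fst_chart hea))
          (Hol.ofOn _ (contMDiffOn_snd_chart hea)) ⟨x, hxe⟩ := by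
    intro η h
    rw [h, Hol.d_ofOn _ _ hxe, Hol.d_ofOn _ _ hxe, scalarDiff_fst hea hxe, scalarDiff_snd hea hxe]
    rfl
  rw [eq_bivCoeff_smul hea hxe (η.1 x), eq_bivCoeff_smul hea hxe (η'.1 x), key η h, key η' h']

/-- At each `x` the bivector is `{s, z}(x) ∂₁ ∧ ∂₂` in the preferred chart at `x`. The identity
`enc` mentions no chart, so it also computes the coefficient in any fixed chart and yields
holomorphy. -/
theorem exists_bivector_encodedBy (P : PoissonStructure (ℂ × ℂ) M) :
    ∃ η : bivectorFields (ℂ × ℂ) M, P.EncodedBy η := by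
  let c (e : OpenPartialHomeomorph M (ℂ × ℂ)) (he : e ∈ atlas (ℂ × ℂ) M) :
      Hol (ℂ × ℂ) (⟨e.source, e.open_source⟩ : Opens M) :=
    P.bracket ⟨e.source, e.open_source⟩ (Hol.ofOn _ (contMDiffOn_fst_chart he))
      (Hol.ofOn _ (contMDiffOn_snd_chart he))
  let η (x : M) : ⋀[ℂ]^2 (TangentSpace 𝓘(ℂ, ℂ × ℂ) x) :=
    c (chartAt (ℂ × ℂ) x) (chart_mem_atlas _ x) ⟨x, mem_chart_source _ x⟩ •
      coordBiv (chartAt (ℂ × ℂ) x) x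
  have enc : ∀ (U : Opens M) (f g : Hol (ℂ × ℂ) U) (x : U),
      P.bracket U f g x = wedgePairing (f.d x.1 : Module.Dual ℂ (TangentSpace 𝓘(ℂ, ℂ × ℂ) x.1))
        (g.d x.1 : Module.Dual ℂ (TangentSpace 𝓘(ℂ, ℂ × ℂ) x.1)) (η x.1) := by
    rintro U f g ⟨x, hx⟩
    have hea : chartAt (ℂ × ℂ) x ∈ atlas (ℂ × ℂ) M := chart_mem_atlas _ x
    have hxe : x ∈ (chartAt (ℂ × ℂ) x).source := mem_chart_source _ x
    have hη : bivCoeff (chartAt (ℂ × ℂ) x) x (η x) = c (chartAt (ℂ × ℂ) x) hea ⟨x, hxe⟩ := by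
      refine (wedgePairing_smul _ _ _ _).trans ?_
      change _ * bivCoeff _ _ _ = _
      rw [bivCoeff_coordBiv hea hxe, mul_one]
    set e := chartAt (ℂ × ℂ) x with he
    let W : Opens M := ⟨e.source ∩ U, e.open_source.inter U.2⟩
    have hWU : W ≤ U := fun y hy => hy.2
    have hxW : x ∈ W := ⟨hxe, hx⟩
    have hWe : W ≤ ⟨e.source, e.open_source⟩ := fun y hy => hy.1
    let s : Hol (ℂ × ℂ) W := (Hol.ofOn _ (contMDiffOn_fst_chart hea)).res hWe
    let z : Hol (ℂ × ℂ) W := (Hol.ofOn _ (contMDiffOn_snd_chart hea)).res hWe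
    have hs : s.d x = coordForm₁ e x := by
      rw [← scalarDiff_fst hea hxe]
      exact Hol.d_eq _ (fun _ => rfl) hxW
    have hz : z.d x = coordForm₂ e x := by
      rw [← scalarDiff_snd hea hxe]
      exact Hol.d_eq _ (fun _ => rfl) hxW
    have key : ∀ k : Hol (ℂ × ℂ) U, (k.res hWU).d x =
        ((k.d x (coordField e ((1, 0) : ℂ × ℂ) x)) • s +
          (k.d x (coordField e ((0, 1) : ℂ × ℂ) x)) • z).d x := by
      intro k
      rw [Hol.d_add _ _ hxW, Hol.d_smul _ _ hxW, Hol.d_smul _ _ hxW, Hol.d_res _ _ hxW, hs, hz]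
      exact covector_expand hea hxe _
    have hsz : P.bracket W s z ⟨x, hxW⟩ = c e hea ⟨x, hxe⟩ := by
      rw [← P.bracket_res]
      rfl
    have self : ∀ k, P.bracket W k k ⟨x, hxW⟩ = 0 := fun k => by
      have h : P.bracket W k k ⟨x, hxW⟩ = -P.bracket W k k ⟨x, hxW⟩ :=
        DFunLike.congr_fun (P.skew W k k) ⟨x, hxW⟩
      linear_combination h / 2
    have hzs : P.bracket W z s ⟨x, hxW⟩ = -c e hea ⟨x, hxe⟩ := by
      rw [P.skew, ← hsz]
      rfl
    have h1 : P.bracket U f g ⟨x, hx⟩ = P.bracket W (f.res hWU) (g.res hWU) ⟨x, hxW⟩ := by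
      rw [← P.bracket_res]
      rfl
    rw [h1]
    refine (P.toSkewBiderivation.bracket_congr hxW (key f) (key g)).trans ?_
    change P.bracket W _ _ ⟨x, hxW⟩ = _
    conv_rhs => rw [covector_expand hea hxe (f.d x), covector_expand hea hxe (g.d x)]
    refine Eq.trans ?_ (wedgePairing_comb (coordForm₁ e x :
      Module.Dual ℂ (TangentSpace 𝓘(ℂ, ℂ × ℂ) x)) (coordForm₂ e x) _ _ _ _ _).symm
    change _ = _ * bivCoeff e x (η x)
    rw [hη]
    generalize f.d x (coordField e ((1, 0) : ℂ × ℂ) x) = a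
    generalize f.d x (coordField e ((0, 1) : ℂ × ℂ) x) = b
    generalize g.d x (coordField e ((1, 0) : ℂ × ℂ) x) = a'
    generalize g.d x (coordField e ((0, 1) : ℂ × ℂ) x) = b'
    simp only [map_add, map_smul, LinearMap.add_apply, LinearMap.smul_apply]
    change a' * (a * P.bracket W s s ⟨x, hxW⟩ + b * P.bracket W z s ⟨x, hxW⟩) +
      b' * (a * P.bracket W s z ⟨x, hxW⟩ + b * P.bracket W z z ⟨x, hxW⟩) = _
    rw [self, self, hsz, hzs]
    ring
  refine ⟨⟨η, mem_bivectorFields fun x₀ => ⟨chartAt (ℂ × ℂ) x₀, chart_mem_atlas _ x₀,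
    mem_chart_source _ x₀, ?_⟩⟩, enc⟩
  have hea : chartAt (ℂ × ℂ) x₀ ∈ atlas (ℂ × ℂ) M := chart_mem_atlas _ x₀
  -- In the fixed chart at `x₀` the coefficient is the holomorphic function `{s, z}` of that chart,
  -- although `η x` was defined with the chart at `x`.
  refine (c _ hea).contMDiffOn_extend.congr fun x hxe => ?_
  rw [(c _ hea).extend_apply ⟨x, hxe⟩]
  refine Eq.trans ?_ (enc _ _ _ _).symm
  rw [Hol.d_ofOn _ _ hxe, Hol.d_ofOn _ _ hxe, scalarDiff_fst hea hxe, scalarDiff_snd hea hxe]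
  rfl

end Surface

/-! ### The tangent line bundle of the curve. -/

section Base

variable {Y : Type*} [TopologicalSpace Y] [ChartedSpace ℂ Y] [IsManifold 𝓘(ℂ) ω Y]

/-- The differential at `y` of the coordinate around `y₀`. -/
def chartForm (y₀ y : Y) : TangentSpace 𝓘(ℂ) y →L[ℂ] ℂ := scalarDiff (chartAt ℂ y₀) y

/-- The coordinate vector field of the chart around `y₀`. -/
def chartField (y₀ y : Y) : TangentSpace 𝓘(ℂ) y := coordField (chartAt ℂ y₀) (1 : ℂ) y

theorem chartForm_chartField {y₀ y : Y} (hy : y ∈ (chartAt ℂ y₀).source) :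
    chartForm y₀ y (chartField y₀ y) = 1 := mfderiv_coordField (chart_mem_atlas ℂ y₀) hy 1

theorem chartForm_smul_chartField {y₀ y : Y} (hy : y ∈ (chartAt ℂ y₀).source)
    (v : TangentSpace 𝓘(ℂ) y) : chartForm y₀ y v • chartField y₀ y = v := by
  have h := coordField_mfderiv (chart_mem_atlas ℂ y₀) hy v
  conv_rhs => rw [← h]
  have : ((mfderiv 𝓘(ℂ) 𝓘(ℂ) (chartAt ℂ y₀) y : ℂ →L[ℂ] ℂ) v : ℂ) = chartForm y₀ y v • (1 : ℂ) :=
    (mul_one (chartForm y₀ y v)).symm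
  rw [this]
  exact (map_smul (mfderiv 𝓘(ℂ) 𝓘(ℂ) (chartAt ℂ y₀).symm (chartAt ℂ y₀ y) : ℂ →L[ℂ] ℂ) _ _).symm

theorem isHolVectorField_chartField (y₀ : Y) :
    IsHolVectorField (chartField y₀) (chartAt ℂ y₀).source :=
  isHolVectorField_coordField (chart_mem_atlas ℂ y₀) 1

theorem covector_eq_smul_chartForm {y₀ y : Y} (hy : y ∈ (chartAt ℂ y₀).source)
    (α : TangentSpace 𝓘(ℂ) y →L[ℂ] ℂ) : α = α (chartField y₀ y) • chartForm y₀ y := by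
  refine ContinuousLinearMap.ext fun v => ?_
  conv_lhs => rw [← chartForm_smul_chartField hy v]
  simp [mul_comm]

/-- Links `ds` to the trivialization of `T_Y` that enters the topology of `Hom(T*_Y, End(E))`. -/
theorem chartForm_eq_continuousLinearMapAt {y₀ y : Y} (hy : y ∈ (chartAt ℂ y₀).source) :
    chartForm y₀ y =
      (trivializationAt ℂ (TangentSpace 𝓘(ℂ) : Y → Type _) y₀).continuousLinearMapAt ℂ y := by
  rw [TangentBundle.continuousLinearMapAt_trivializationAt hy]
  simp only [chartForm, scalarDiff, mfld_simps]
  rfl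

end Base

/-! ### Endomorphisms of the fibres as matrices. -/

section Matrices

variable {Y : Type*} [TopologicalSpace Y] [ChartedSpace ℂ Y]
  {E : Y → Type*} [∀ y, AddCommGroup (E y)] [∀ y, Module ℂ (E y)]
  [∀ y, TopologicalSpace (E y)] [TopologicalSpace (Bundle.TotalSpace (Fin 2 → ℂ) E)]
  [FiberBundle (Fin 2 → ℂ) E] [VectorBundle ℂ (Fin 2 → ℂ) E]

/-- The matrix of an endomorphism of `E y` in the trivialization around `y₀`. -/
def endMatrix (y₀ y : Y) (A : E y →L[ℂ] E y) : (Fin 2 → ℂ) →L[ℂ] (Fin 2 → ℂ) :=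
  ContinuousLinearMap.inCoordinates (Fin 2 → ℂ) E (Fin 2 → ℂ) E y₀ y y₀ y A

theorem endMatrix_apply (y₀ y : Y) (A : E y →L[ℂ] E y) (w : Fin 2 → ℂ) :
    endMatrix y₀ y A w = ProjBundle.triv y₀ y (A (ProjBundle.trivSymm y₀ y w)) := rfl

/-- The endomorphism of `E y` with a given matrix in the trivialization around `y₀`. -/
def endOfMatrix (y₀ y : Y) (m : (Fin 2 → ℂ) →L[ℂ] (Fin 2 → ℂ)) : E y →L[ℂ] E y :=
  (trivializationAt (Fin 2 → ℂ) E y₀).symmL ℂ y ∘L m ∘L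
    (trivializationAt (Fin 2 → ℂ) E y₀).continuousLinearMapAt ℂ y

theorem endMatrix_endOfMatrix {y₀ y : Y} (hy : y ∈ (trivializationAt (Fin 2 → ℂ) E y₀).baseSet)
    (m : (Fin 2 → ℂ) →L[ℂ] (Fin 2 → ℂ)) : endMatrix y₀ y (endOfMatrix (E := E) y₀ y m) = m := by
  ext1 w
  rw [endMatrix_apply]
  change ProjBundle.triv y₀ y (ProjBundle.trivSymm (E := E) y₀ y (m (ProjBundle.triv y₀ y
    (ProjBundle.trivSymm (E := E) y₀ y w)))) = _
  rw [ProjBundle.triv_trivSymm hy, ProjBundle.triv_trivSymm hy]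

theorem endOfMatrix_endMatrix {y₀ y : Y} (hy : y ∈ (trivializationAt (Fin 2 → ℂ) E y₀).baseSet)
    (A : E y →L[ℂ] E y) : endOfMatrix y₀ y (endMatrix y₀ y A) = A := by
  ext1 v
  change ProjBundle.trivSymm (E := E) y₀ y (ProjBundle.triv y₀ y (A (ProjBundle.trivSymm y₀ y
    (ProjBundle.triv y₀ y v)))) = _
  rw [ProjBundle.trivSymm_triv hy, ProjBundle.trivSymm_triv hy]

theorem trace_endMatrix {y₀ y : Y} (hy : y ∈ (trivializationAt (Fin 2 → ℂ) E y₀).baseSet)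
    (A : E y →L[ℂ] E y) :
    LinearMap.trace ℂ _ (endMatrix y₀ y A : (Fin 2 → ℂ) →ₗ[ℂ] (Fin 2 → ℂ)) =
      LinearMap.trace ℂ (E y) (A : E y →ₗ[ℂ] E y) := by
  let f : E y ≃ₗ[ℂ] (Fin 2 → ℂ) :=
    { ProjBundle.triv y₀ y with
      invFun := ProjBundle.trivSymm y₀ y
      left_inv := ProjBundle.trivSymm_triv hy
      right_inv := ProjBundle.triv_trivSymm hy }
  rw [← LinearMap.trace_conj' (A : E y →ₗ[ℂ] E y) f]
  rfl

variable [∀ y, IsTopologicalAddGroup (E y)] [∀ y, ContinuousSMul ℂ (E y)]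

/-- The traceless endomorphism of `E y` with a given traceless matrix. -/
def end₀OfMatrix {y₀ y : Y} (hy : y ∈ (trivializationAt (Fin 2 → ℂ) E y₀).baseSet)
    (m : (Fin 2 → ℂ) →L[ℂ] (Fin 2 → ℂ))
    (hm : LinearMap.trace ℂ _ (m : (Fin 2 → ℂ) →ₗ[ℂ] (Fin 2 → ℂ)) = 0) : End₀ E y :=
  ⟨endOfMatrix y₀ y m, by
    change LinearMap.trace ℂ (E y) ((endOfMatrix y₀ y m : E y →L[ℂ] E y) : E y →ₗ[ℂ] E y) = 0
    rw [← trace_endMatrix hy, endMatrix_endOfMatrix hy, hm]⟩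

theorem endMatrix_add (y₀ y : Y) (A B : E y →L[ℂ] E y) :
    endMatrix y₀ y (A + B) = endMatrix y₀ y A + endMatrix y₀ y B := by
  ext1 w
  simp [endMatrix_apply]

theorem endMatrix_smul (y₀ y : Y) (c : ℂ) (A : E y →L[ℂ] E y) :
    endMatrix y₀ y (c • A) = c • endMatrix y₀ y A := by
  ext1 w
  simp [endMatrix_apply]

end Matrices

/-! ### Sections of `T_Y ⊗ End₀(E)` as matrix-valued functions. -/

section Sections

variable {Y : Type*} [TopologicalSpace Y] [ChartedSpace ℂ Y] [IsManifold 𝓘(ℂ) ω Y]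
  {E : Y → Type*} [∀ y, AddCommGroup (E y)] [∀ y, Module ℂ (E y)]
  [∀ y, TopologicalSpace (E y)] [TopologicalSpace (Bundle.TotalSpace (Fin 2 → ℂ) E)]
  [FiberBundle (Fin 2 → ℂ) E] [VectorBundle ℂ (Fin 2 → ℂ) E]
  [ContMDiffVectorBundle ω (Fin 2 → ℂ) E 𝓘(ℂ)]
  [∀ y, IsTopologicalAddGroup (E y)] [∀ y, ContinuousSMul ℂ (E y)]

theorem contMDiffVectorBundle_end :
    ContMDiffVectorBundle ω ((Fin 2 → ℂ) →L[ℂ] (Fin 2 → ℂ)) (fun y => E y →L[ℂ] E y) 𝓘(ℂ) :=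
  ContMDiffVectorBundle.continuousLinearMap

theorem isHolEnd₀_iff {A : ∀ y, End₀ E y} {U : Set Y} (hU : IsOpen U) {y₀ : Y}
    (hy : U ⊆ (trivializationAt (Fin 2 → ℂ) E y₀).baseSet) :
    IsHolEnd₀ A U ↔ ContMDiffOn 𝓘(ℂ) 𝓘(ℂ, (Fin 2 → ℂ) →L[ℂ] (Fin 2 → ℂ)) ω
      (fun y => endMatrix y₀ y (A y).1) U := by
  have := contMDiffVectorBundle_end (E := E)
  exact (trivializationAt ((Fin 2 → ℂ) →L[ℂ] (Fin 2 → ℂ)) (fun y => E y →L[ℂ] E y)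
    y₀).contMDiffOn_section_iff hU (fun y h => by
      rw [hom_trivializationAt_baseSet]
      exact ⟨hy h, hy h⟩)

/-- The matrix in the trivialization around `y₀` of the contraction with the differential of the
coordinate around `y₀`. -/
def tensorMatrix (y₀ y : Y) (t : TangentSpace 𝓘(ℂ) y ⊗[ℂ] End₀ E y) :
    (Fin 2 → ℂ) →L[ℂ] (Fin 2 → ℂ) := endMatrix y₀ y (contract (chartForm y₀ y) t).1

omit [ContMDiffVectorBundle ω (Fin 2 → ℂ) E 𝓘(ℂ)] in
theorem tensorMatrix_add (y₀ y : Y) (t t' : TangentSpace 𝓘(ℂ) y ⊗[ℂ] End₀ E y) :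
    tensorMatrix y₀ y (t + t') = tensorMatrix y₀ y t + tensorMatrix y₀ y t' := by
  rw [tensorMatrix, map_add]
  exact endMatrix_add _ _ _ _

omit [ContMDiffVectorBundle ω (Fin 2 → ℂ) E 𝓘(ℂ)] in
theorem tensorMatrix_smul (y₀ y : Y) (c : ℂ) (t : TangentSpace 𝓘(ℂ) y ⊗[ℂ] End₀ E y) :
    tensorMatrix y₀ y (c • t) = c • tensorMatrix y₀ y t := by
  rw [tensorMatrix, map_smul]
  exact endMatrix_smul _ _ _ _

omit [ContMDiffVectorBundle ω (Fin 2 → ℂ) E 𝓘(ℂ)] in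
-- The tangent space is a line spanned by the coordinate field, with dual covector `ds`, so every
-- tensor is `∂_s ⊗ A` with `A` its contraction with `ds`.
theorem tmul_contract {y₀ y : Y} (hy : y ∈ (chartAt ℂ y₀).source)
    (t : TangentSpace 𝓘(ℂ) y ⊗[ℂ] End₀ E y) :
    chartField y₀ y ⊗ₜ contract (chartForm y₀ y) t = t := by
  induction t with
  | zero => simp
  | add t t' h h' => rw [map_add, TensorProduct.tmul_add, h, h']
  | tmul v A =>
    rw [contract_tmul, ← TensorProduct.smul_tmul, chartForm_smul_chartField hy]

omit [ContMDiffVectorBundle ω (Fin 2 → ℂ) E 𝓘(ℂ)] in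
theorem tensorMatrix_injective {y₀ y : Y} (hy : y ∈ ProjBundle.dom E y₀)
    {t t' : TangentSpace 𝓘(ℂ) y ⊗[ℂ] End₀ E y} (h : tensorMatrix y₀ y t = tensorMatrix y₀ y t') :
    t = t' := by
  have h2 := congrArg (endOfMatrix (E := E) y₀ y) h
  unfold tensorMatrix at h2
  rw [endOfMatrix_endMatrix hy.2, endOfMatrix_endMatrix hy.2] at h2
  rw [← tmul_contract hy.1 t, ← tmul_contract hy.1 t', Subtype.ext h2]

/-- For a local sum `∑ Zᵢ ⊗ Aᵢ` the matrix is the sum of the matrices of the `Aᵢ` weighted by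
`ds(Zᵢ)`. -/
theorem contMDiffOn_tensorMatrix (φ : vectorTensorEnd₀ E) (y₀ : Y) :
    ContMDiffOn 𝓘(ℂ) 𝓘(ℂ, (Fin 2 → ℂ) →L[ℂ] (Fin 2 → ℂ)) ω
      (fun y => tensorMatrix y₀ y (φ.1 y)) (ProjBundle.dom E y₀) := by
  intro y hy
  obtain ⟨U, hU, hyU, n, Z, A, hZ, hA, hφ⟩ := φ.2 y
  have ho : IsOpen (U ∩ ProjBundle.dom E y₀) := hU.inter (ProjBundle.isOpen_dom y₀)
  have key : ContMDiffOn 𝓘(ℂ) 𝓘(ℂ, (Fin 2 → ℂ) →L[ℂ] (Fin 2 → ℂ)) ω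
      (fun y => ∑ i, chartForm y₀ y (Z i y) • endMatrix y₀ y (A i y).1)
      (U ∩ ProjBundle.dom E y₀) := by
    refine contMDiffOn_finsetSum fun i _ => ?_
    have h1 := ((hZ i).mono (Set.inter_subset_left (t := ProjBundle.dom E y₀))).scalarDiff_apply ho
      ((contMDiffOn_of_mem_atlas (chart_mem_atlas ℂ y₀)).mono fun y hy => hy.2.1)
    have h2 := (isHolEnd₀_iff ho fun y hy => hy.2.2).1 (ContMDiffOn.mono (hA i) Set.inter_subset_left)
    exact h1.smul h2
  have key' := key.congr (f₁ := fun y => tensorMatrix y₀ y (φ.1 y)) (fun y hy => by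
    rw [hφ y hy.1]
    let Lm : TangentSpace 𝓘(ℂ) y ⊗[ℂ] End₀ E y →ₗ[ℂ] ((Fin 2 → ℂ) →L[ℂ] (Fin 2 → ℂ)) :=
      { toFun := tensorMatrix y₀ y
        map_add' := tensorMatrix_add y₀ y
        map_smul' := tensorMatrix_smul y₀ y }
    refine (map_sum Lm _ _).trans (Finset.sum_congr rfl fun i _ => ?_)
    change tensorMatrix y₀ y _ = _
    rw [tensorMatrix, contract_tmul]
    exact endMatrix_smul _ _ _ _)
  exact (key'.contMDiffAt (ho.mem_nhds ⟨hyU, hy⟩)).contMDiffWithinAt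

/-- Around `y₀` the section is the single term `∂_s ⊗ A`, with `A` the contraction with `ds`. -/
theorem mem_vectorTensorEnd₀ {φ : ∀ y : Y, TangentSpace 𝓘(ℂ) y ⊗[ℂ] End₀ E y}
    (h : ∀ y₀, ContMDiffOn 𝓘(ℂ) 𝓘(ℂ, (Fin 2 → ℂ) →L[ℂ] (Fin 2 → ℂ)) ω
      (fun y => tensorMatrix y₀ y (φ y)) (ProjBundle.dom E y₀)) : φ ∈ vectorTensorEnd₀ E := by
  intro y₀
  refine ⟨ProjBundle.dom E y₀, ProjBundle.isOpen_dom y₀,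
    ⟨mem_chart_source ℂ y₀, FiberBundle.mem_baseSet_trivializationAt _ E y₀⟩, 1,
    fun _ => chartField y₀, fun _ y => contract (chartForm y₀ y) (φ y),
    fun _ => (isHolVectorField_chartField y₀).mono fun y hy => hy.1,
    fun _ => (isHolEnd₀_iff (ProjBundle.isOpen_dom y₀) fun y hy => hy.2).2 (h y₀),
    fun y hy => ?_⟩
  rw [Finset.univ_unique, Finset.sum_singleton, tmul_contract hy.1]

end Sections

/-! ### Sections of `T_Y ⊗ End₀(E)` and bundle maps from the cotangent bundle. -/

section BundleMaps

variable {Y : Type*} [TopologicalSpace Y] [ChartedSpace ℂ Y] [IsManifold 𝓘(ℂ) ω Y]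
  {E : Y → Type*} [∀ y, AddCommGroup (E y)] [∀ y, Module ℂ (E y)]
  [∀ y, TopologicalSpace (E y)] [TopologicalSpace (Bundle.TotalSpace (Fin 2 → ℂ) E)]
  [FiberBundle (Fin 2 → ℂ) E] [VectorBundle ℂ (Fin 2 → ℂ) E]
  [ContMDiffVectorBundle ω (Fin 2 → ℂ) E 𝓘(ℂ)]
  [∀ y, IsTopologicalAddGroup (E y)] [∀ y, ContinuousSMul ℂ (E y)]

omit [ContMDiffVectorBundle ω (Fin 2 → ℂ) E 𝓘(ℂ)] in
theorem end_continuousLinearMapAt {y₀ y : Y}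
    (hy : y ∈ (trivializationAt (Fin 2 → ℂ) E y₀).baseSet) (A : E y →L[ℂ] E y) :
    (trivializationAt ((Fin 2 → ℂ) →L[ℂ] (Fin 2 → ℂ)) (fun y => E y →L[ℂ] E y)
      y₀).continuousLinearMapAt ℂ y A = endMatrix y₀ y A := by
  rw [Bundle.Trivialization.continuousLinearMapAt_apply,
    Bundle.Trivialization.linearMapAt_apply, if_pos, hom_trivializationAt_apply]
  · rfl
  · rw [hom_trivializationAt_baseSet]
    exact ⟨hy, hy⟩

theorem cotangent_symmL {y₀ y : Y} (hy : y ∈ (chartAt ℂ y₀).source) (c : ℂ →L[ℂ] ℂ) :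
    (trivializationAt (ℂ →L[ℂ] ℂ) (fun y : Y => TangentSpace 𝓘(ℂ) y →L[ℂ] ℂ) y₀).symmL ℂ y c =
      c ∘L chartForm y₀ y := by
  have hb : y ∈ (trivializationAt (ℂ →L[ℂ] ℂ)
      (fun y : Y => TangentSpace 𝓘(ℂ) y →L[ℂ] ℂ) y₀).baseSet := by
    refine (hom_trivializationAt_baseSet (RingHom.id ℂ) (F₁ := ℂ) (F₂ := ℂ)
      (E₁ := (TangentSpace 𝓘(ℂ) : Y → Type _)) (E₂ := Bundle.Trivial Y ℂ) y₀).symm ▸ ⟨?_, trivial⟩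
    rwa [TangentBundle.trivializationAt_baseSet]
  have hT : y ∈ (trivializationAt ℂ (TangentSpace 𝓘(ℂ) : Y → Type _) y₀).baseSet := by
    rwa [TangentBundle.trivializationAt_baseSet]
  -- The forward trivialization has an explicit formula; its inverse is obtained by checking that `c
  -- ∘ ds` is sent to `c`.
  have h : c = (trivializationAt (ℂ →L[ℂ] ℂ)
      (fun y : Y => TangentSpace 𝓘(ℂ) y →L[ℂ] ℂ) y₀).continuousLinearMapAt ℂ y
        (c ∘L chartForm y₀ y) := by
    rw [Bundle.Trivialization.continuousLinearMapAt_apply,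
      Bundle.Trivialization.linearMapAt_apply, if_pos hb]
    refine Eq.trans ?_ (congrArg Prod.snd (hom_trivializationAt_apply (RingHom.id ℂ) (F₁ := ℂ)
      (F₂ := ℂ) (E₁ := (TangentSpace 𝓘(ℂ) : Y → Type _)) (E₂ := Bundle.Trivial Y ℂ) y₀
      ⟨y, c ∘L chartForm y₀ y⟩)).symm
    refine ContinuousLinearMap.ext fun t => ?_
    change c t = ((trivializationAt ℂ (Bundle.Trivial Y ℂ) y₀).continuousLinearMapAt ℂ y)
      (c (chartForm y₀ y ((trivializationAt ℂ (TangentSpace 𝓘(ℂ) : Y → Type _) y₀).symmL ℂ y t)))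
    rw [chartForm_eq_continuousLinearMapAt hy, Bundle.Trivialization.continuousLinearMapAt_symmL _ hT]
    simp
  conv_lhs => rw [h]
  exact Bundle.Trivialization.symmL_continuousLinearMapAt _ hb _

theorem contMDiffOn_smulRight {F G : Type*} [NormedAddCommGroup F] [NormedSpace ℂ F]
    [NormedAddCommGroup G] [NormedSpace ℂ G] (c : F →L[ℂ] ℂ) {m : Y → G} {s : Set Y}
    (h : ContMDiffOn 𝓘(ℂ) 𝓘(ℂ, G) ω m s) :
    ContMDiffOn 𝓘(ℂ) 𝓘(ℂ, F →L[ℂ] G) ω (fun y => c.smulRight (m y)) s :=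
  (ContinuousLinearMap.smulRightL ℂ F G c).contMDiff.comp_contMDiffOn h

theorem contMDiffOn_eval {F G : Type*} [NormedAddCommGroup F] [NormedSpace ℂ F]
    [NormedAddCommGroup G] [NormedSpace ℂ G] (v : F) {m : Y → F →L[ℂ] G} {s : Set Y}
    (h : ContMDiffOn 𝓘(ℂ) 𝓘(ℂ, F →L[ℂ] G) ω m s) :
    ContMDiffOn 𝓘(ℂ) 𝓘(ℂ, G) ω (fun y => m y v) s :=
  (ContinuousLinearMap.apply ℂ G v).contMDiff.comp_contMDiffOn h

set_option synthInstance.maxHeartbeats 200000 in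
set_option maxHeartbeats 800000 in
/-- Holomorphy of a family of linear maps `T*_y Y → End(E y)`, in a local trivialization. -/
theorem contMDiffOn_bundleMap_iff
    (θ : ∀ y : Y, (TangentSpace 𝓘(ℂ) y →L[ℂ] ℂ) →L[ℂ] (E y →L[ℂ] E y)) (y₀ : Y) :
    ContMDiffOn 𝓘(ℂ) (𝓘(ℂ).prod 𝓘(ℂ, (ℂ →L[ℂ] ℂ) →L[ℂ] ((Fin 2 → ℂ) →L[ℂ] (Fin 2 → ℂ)))) ω
      (fun y => Bundle.TotalSpace.mk' ((ℂ →L[ℂ] ℂ) →L[ℂ] ((Fin 2 → ℂ) →L[ℂ] (Fin 2 → ℂ)))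
        (E := fun y : Y => (TangentSpace 𝓘(ℂ) y →L[ℂ] ℂ) →L[ℂ] (E y →L[ℂ] E y)) y (θ y))
      (ProjBundle.dom E y₀) ↔
    ContMDiffOn 𝓘(ℂ) 𝓘(ℂ, (Fin 2 → ℂ) →L[ℂ] (Fin 2 → ℂ)) ω
      (fun y => endMatrix y₀ y (θ y (chartForm y₀ y))) (ProjBundle.dom E y₀) := by
  have hsub : ProjBundle.dom E y₀ ⊆ (trivializationAt
      ((ℂ →L[ℂ] ℂ) →L[ℂ] ((Fin 2 → ℂ) →L[ℂ] (Fin 2 → ℂ)))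
      (fun y : Y => (TangentSpace 𝓘(ℂ) y →L[ℂ] ℂ) →L[ℂ] (E y →L[ℂ] E y)) y₀).baseSet := by
    intro y hy
    rw [hom_trivializationAt_baseSet, hom_trivializationAt_baseSet]
    refine ⟨?_, hy.2, hy.2⟩
    refine (hom_trivializationAt_baseSet (RingHom.id ℂ) (F₁ := ℂ) (F₂ := ℂ)
      (E₁ := (TangentSpace 𝓘(ℂ) : Y → Type _)) (E₂ := Bundle.Trivial Y ℂ) y₀).symm ▸ ⟨?_, trivial⟩
    rw [TangentBundle.trivializationAt_baseSet]
    exact hy.1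
  rw [(trivializationAt ((ℂ →L[ℂ] ℂ) →L[ℂ] ((Fin 2 → ℂ) →L[ℂ] (Fin 2 → ℂ)))
    (fun y : Y => (TangentSpace 𝓘(ℂ) y →L[ℂ] ℂ) →L[ℂ] (E y →L[ℂ] E y))
    y₀).contMDiffOn_section_iff (ProjBundle.isOpen_dom y₀) hsub]
  -- The cotangent space is a line, so the local expression of `θ` is determined by the value of `θ`
  -- on `ds`, which corresponds to `c = id`.
  have key : ∀ y ∈ ProjBundle.dom E y₀, ∀ c : ℂ →L[ℂ] ℂ,
      ((trivializationAt ((ℂ →L[ℂ] ℂ) →L[ℂ] ((Fin 2 → ℂ) →L[ℂ] (Fin 2 → ℂ)))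
        (fun y : Y => (TangentSpace 𝓘(ℂ) y →L[ℂ] ℂ) →L[ℂ] (E y →L[ℂ] E y)) y₀) ⟨y, θ y⟩).2 c =
      c 1 • endMatrix y₀ y (θ y (chartForm y₀ y)) := by
    intro y hy c
    rw [hom_trivializationAt_apply]
    change (trivializationAt ((Fin 2 → ℂ) →L[ℂ] (Fin 2 → ℂ)) (fun y => E y →L[ℂ] E y)
      y₀).continuousLinearMapAt ℂ y (θ y ((trivializationAt (ℂ →L[ℂ] ℂ)
        (fun y : Y => TangentSpace 𝓘(ℂ) y →L[ℂ] ℂ) y₀).symmL ℂ y c)) = _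
    rw [cotangent_symmL hy.1, end_continuousLinearMapAt hy.2]
    have : c ∘L chartForm y₀ y = c 1 • chartForm y₀ y := by
      refine ContinuousLinearMap.ext fun v => ?_
      change c (chartForm y₀ y v) = c 1 * chartForm y₀ y v
      conv_lhs => rw [← mul_one (chartForm y₀ y v), ← smul_eq_mul, map_smul, smul_eq_mul, mul_comm]
    rw [this, map_smul, endMatrix_smul]
  constructor
  · intro h
    refine (contMDiffOn_eval (ContinuousLinearMap.id ℂ ℂ) h).congr
      fun y hy => ?_
    rw [key y hy]
    simp
  · intro h
    refine (contMDiffOn_smulRight (ContinuousLinearMap.apply ℂ ℂ (1 : ℂ)) h).congr fun y hy => ContinuousLinearMap.ext fun c => ?_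
    rw [key y hy]
    rfl

omit [ContMDiffVectorBundle ω (Fin 2 → ℂ) E 𝓘(ℂ)] in
theorem contract_smul {y : Y} (c : ℂ) (α : TangentSpace 𝓘(ℂ) y →L[ℂ] ℂ)
    (t : TangentSpace 𝓘(ℂ) y ⊗[ℂ] End₀ E y) : contract (c • α) t = c • contract α t := by
  induction t with
  | zero => simp
  | add t t' h h' => rw [map_add, map_add, h, h', smul_add]
  | tmul v A =>
    rw [contract_tmul, contract_tmul, smul_smul]
    rfl

omit [ContMDiffVectorBundle ω (Fin 2 → ℂ) E 𝓘(ℂ)] in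
theorem contract_eq {y₀ y : Y} (hy : y ∈ (chartAt ℂ y₀).source)
    (α : TangentSpace 𝓘(ℂ) y →L[ℂ] ℂ) (t : TangentSpace 𝓘(ℂ) y ⊗[ℂ] End₀ E y) :
    contract α t = α (chartField y₀ y) • contract (chartForm y₀ y) t := by
  conv_lhs => rw [covector_eq_smul_chartForm hy α]
  exact contract_smul _ _ _

/-- Evaluation of covectors at a tangent vector. -/
def covectorEval {y : Y} (v : TangentSpace 𝓘(ℂ) y) : (TangentSpace 𝓘(ℂ) y →L[ℂ] ℂ) →L[ℂ] ℂ :=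
  (ContinuousLinearMap.apply ℂ ℂ (v : ℂ) : (ℂ →L[ℂ] ℂ) →L[ℂ] ℂ)

/-- Sections of `T_Y ⊗ End₀(E)` are the same as bundle maps `T*_Y → End₀(E)`. -/
theorem exists_bundleMap_of_section (φ : vectorTensorEnd₀ E) :
    ∃ θ : CotangentToEnd₀ E, ∀ y α, θ.1 y α = contract α (φ.1 y) := by
  -- The contraction `α ↦ ⟨α, φ y⟩` written as a rank-one operator in the chart at `y`, which makes
  -- it visibly a continuous linear map.
  let θ (y : Y) : (TangentSpace 𝓘(ℂ) y →L[ℂ] ℂ) →L[ℂ] End₀ E y :=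
    (covectorEval (chartField y y)).smulRight (contract (chartForm y y) (φ.1 y))
  have hθ : ∀ y α, θ y α = contract α (φ.1 y) := fun y α =>
    (contract_eq (mem_chart_source ℂ y) α _).symm
  refine ⟨⟨θ, fun y₀ => ?_⟩, hθ⟩
  refine ((contMDiffOn_bundleMap_iff (fun y => (End₀ E y).subtypeL ∘L θ y) y₀).2
    ((contMDiffOn_tensorMatrix φ y₀).congr fun y _ => ?_)).contMDiffAt
    ((ProjBundle.isOpen_dom y₀).mem_nhds
      ⟨mem_chart_source ℂ y₀, FiberBundle.mem_baseSet_trivializationAt _ E y₀⟩)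
  change endMatrix y₀ y (θ y (chartForm y₀ y)).1 = _
  rw [hθ]
  rfl

theorem exists_section_of_bundleMap (θ : CotangentToEnd₀ E) :
    ∃ φ : vectorTensorEnd₀ E, ∀ y α, θ.1 y α = contract α (φ.1 y) := by
  -- The tensor `∂_s ⊗ θ(ds)` does not depend on the chart; the chart at `y` is merely available at
  -- every `y`.
  let φ (y : Y) : TangentSpace 𝓘(ℂ) y ⊗[ℂ] End₀ E y := chartField y y ⊗ₜ θ.1 y (chartForm y y)
  have hφ : ∀ y α, θ.1 y α = contract α (φ y) := fun y α => by
    rw [contract_tmul]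
    conv_lhs => rw [covector_eq_smul_chartForm (mem_chart_source ℂ y) α]
    exact (θ.1 y).map_smul _ _
  refine ⟨⟨φ, mem_vectorTensorEnd₀ fun y₀ => ?_⟩, hφ⟩
  refine ((contMDiffOn_bundleMap_iff _ y₀).1 θ.2.contMDiffOn).congr fun y _ => ?_
  rw [tensorMatrix, ← hφ]
  rfl

omit [ContMDiffVectorBundle ω (Fin 2 → ℂ) E 𝓘(ℂ)] in
theorem eq_of_contract_eq {y : Y} {t t' : TangentSpace 𝓘(ℂ) y ⊗[ℂ] End₀ E y}
    (h : ∀ α : TangentSpace 𝓘(ℂ) y →L[ℂ] ℂ, contract α t = contract α t') : t = t' := by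
  rw [← tmul_contract (mem_chart_source ℂ y) t, h, tmul_contract (mem_chart_source ℂ y)]

end BundleMaps

/-! ### Affine charts of `ℙ(E)` and the correspondence in coordinates. -/

section Projective

variable {Y : Type*} [TopologicalSpace Y] [ChartedSpace ℂ Y] [IsManifold 𝓘(ℂ) ω Y]
  {E : Y → Type*} [∀ y, AddCommGroup (E y)] [∀ y, Module ℂ (E y)]
  [∀ y, TopologicalSpace (E y)] [TopologicalSpace (Bundle.TotalSpace (Fin 2 → ℂ) E)]
  [FiberBundle (Fin 2 → ℂ) E] [VectorBundle ℂ (Fin 2 → ℂ) E]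
  [ContMDiffVectorBundle ω (Fin 2 → ℂ) E 𝓘(ℂ)]

namespace ProjBundle

/-- The affine chart `chart x₀ i` of `ℙ(E)`, as an open partial homeomorphism. -/
def affineChart (x₀ : ProjBundle E) (i : Fin 2) : OpenPartialHomeomorph (ProjBundle E) (ℂ × ℂ) :=
  (core E).openPartialHomeomorph (chart x₀ i) ⟨(x₀, i), rfl⟩

theorem affineChart_mem_atlas (x₀ : ProjBundle E) (i : Fin 2) :
    affineChart x₀ i ∈ atlas (ℂ × ℂ) (ProjBundle E) := by
  change affineChart x₀ i ∈ (⋃ (e : PartialEquiv (ProjBundle E) (ℂ × ℂ)) (he : e ∈ (core E).atlas),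
    {(core E).openPartialHomeomorph e he})
  simp only [Set.mem_iUnion, Set.mem_singleton_iff]
  exact ⟨chart x₀ i, ⟨(x₀, i), rfl⟩, rfl⟩

theorem affineChart_apply (x₀ x : ProjBundle E) (i : Fin 2) :
    affineChart x₀ i x =
      (chartAt ℂ x₀.base x.base, coord x₀.base x (i + 1) / coord x₀.base x i) := rfl

theorem pt_eq_symm {x₀ : ProjBundle E} {i : Fin 2} {y : Y} (hy : y ∈ dom E x₀.base) (z : ℂ) :
    pt x₀ i y z = (affineChart x₀ i).symm (chartAt ℂ x₀.base y, z) := by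
  change _ = pt x₀ i ((chartAt ℂ x₀.base).symm (chartAt ℂ x₀.base y)) z
  rw [(chartAt ℂ x₀.base).left_inv hy.1]

theorem mem_affineChart_target {x₀ : ProjBundle E} {i : Fin 2} {y : Y} (hy : y ∈ dom E x₀.base)
    (z : ℂ) : (chartAt ℂ x₀.base y, z) ∈ (affineChart x₀ i).target := by
  refine ⟨(chartAt ℂ x₀.base).map_source hy.1, ?_⟩
  change (chartAt ℂ x₀.base).symm (chartAt ℂ x₀.base y) ∈ _
  rw [(chartAt ℂ x₀.base).left_inv hy.1]
  exact hy.2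

theorem pt_mem_source {x₀ : ProjBundle E} {i : Fin 2} {y : Y} (hy : y ∈ dom E x₀.base) (z : ℂ) :
    pt x₀ i y z ∈ (affineChart x₀ i).source := by
  rw [pt_eq_symm hy]
  exact (affineChart x₀ i).map_target (mem_affineChart_target hy z)

theorem affineChart_pt {x₀ : ProjBundle E} {i : Fin 2} {y : Y} (hy : y ∈ dom E x₀.base) (z : ℂ) :
    affineChart x₀ i (pt x₀ i y z) = (chartAt ℂ x₀.base y, z) := by
  rw [pt_eq_symm hy]
  exact (affineChart x₀ i).right_inv (mem_affineChart_target hy z)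

theorem pt_base {x₀ : ProjBundle E} {i : Fin 2} {y : Y} (hy : y ∈ dom E x₀.base) (z : ℂ) :
    (pt x₀ i y z).base = y := by rw [pt_eq hy.2]

theorem pt_affineChart {x₀ x : ProjBundle E} {i : Fin 2} (hx : x ∈ (affineChart x₀ i).source) :
    pt x₀ i x.base (affineChart x₀ i x).2 = x := pt_coord hx.1.2 hx.2

theorem contMDiff_pt {x₀ : ProjBundle E} {i : Fin 2} {y : Y} (hy : y ∈ dom E x₀.base) :
    ContMDiff 𝓘(ℂ) 𝓘(ℂ, ℂ × ℂ) ω (pt x₀ i y) := by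
  have h1 : ContMDiff 𝓘(ℂ) 𝓘(ℂ, ℂ × ℂ) ω (fun z : ℂ => (chartAt ℂ x₀.base y, z)) :=
    (contDiff_const.prodMk contDiff_id).contMDiff
  have h2 := (contMDiffOn_symm_of_mem_atlas (affineChart_mem_atlas x₀ i)).comp
    (h1.contMDiffOn (s := Set.univ)) (fun z _ => mem_affineChart_target (i := i) hy z)
  rw [contMDiffOn_univ] at h2
  exact h2.congr fun z => pt_eq_symm hy z

/-- The local section of `ℙ(E)` with constant affine coordinate; pulling back along it gives
holomorphic dependence on the base point. -/
theorem contMDiffOn_pt (x₀ : ProjBundle E) (i : Fin 2) (z : ℂ) :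
    ContMDiffOn 𝓘(ℂ) 𝓘(ℂ, ℂ × ℂ) ω (fun y => pt x₀ i y z) (dom E x₀.base) := by
  have h0 : ContMDiff 𝓘(ℂ) 𝓘(ℂ, ℂ × ℂ) ω (fun s : ℂ => (s, z)) :=
    (contDiff_id.prodMk contDiff_const).contMDiff
  have h1 := h0.comp_contMDiffOn ((contMDiffOn_of_mem_atlas (chart_mem_atlas ℂ x₀.base)).mono
    fun y (hy : y ∈ dom E x₀.base) => hy.1)
  exact ((contMDiffOn_symm_of_mem_atlas (affineChart_mem_atlas x₀ i)).comp h1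
    (fun y hy => mem_affineChart_target (i := i) hy z)).congr fun y hy => pt_eq_symm hy z

theorem contMDiffOn_base_affineChart (x₀ : ProjBundle E) (i : Fin 2) :
    ContMDiffOn 𝓘(ℂ, ℂ × ℂ) 𝓘(ℂ) ω (base : ProjBundle E → Y) (affineChart x₀ i).source := by
  refine ((contMDiffOn_symm_of_mem_atlas (chart_mem_atlas ℂ x₀.base)).comp
    (contMDiffOn_fst_chart (affineChart_mem_atlas x₀ i)) fun x hx => ?_).congr fun x hx => ?_
  · exact (chartAt ℂ x₀.base).map_source hx.1.1
  · exact ((chartAt ℂ x₀.base).left_inv hx.1.1).symm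

/-- Some point of `ℙ(E)` over `y`. -/
def pointOver (E : Y → Type*) [∀ y, AddCommGroup (E y)] [∀ y, Module ℂ (E y)]
    [∀ y, TopologicalSpace (E y)] [TopologicalSpace (Bundle.TotalSpace (Fin 2 → ℂ) E)]
    [FiberBundle (Fin 2 → ℂ) E] [VectorBundle ℂ (Fin 2 → ℂ) E] (y : Y) : ProjBundle E :=
  ⟨y, Projectivization.mk ℂ _ (trivSymm_vec_ne_zero
    (FiberBundle.mem_baseSet_trivializationAt (Fin 2 → ℂ) E y) 0 0)⟩

omit [ContMDiffVectorBundle ω (Fin 2 → ℂ) E 𝓘(ℂ)] [IsManifold 𝓘(ℂ) ω Y] in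
theorem mem_dom (y : Y) : y ∈ dom E y :=
  ⟨mem_chart_source ℂ y, FiberBundle.mem_baseSet_trivializationAt (Fin 2 → ℂ) E y⟩

/-- The vector field on the affine line in `ℙ¹` with coordinate `z = w_{i+1} / w_i` induced by the
infinitesimal symmetry `m` of `ℂ²`. -/
def affineField (i : Fin 2) (m : (Fin 2 → ℂ) →L[ℂ] (Fin 2 → ℂ)) (z : ℂ) : ℂ :=
  m (vec i z) (i + 1) - z * m (vec i z) i

omit [ContMDiffVectorBundle ω (Fin 2 → ℂ) E 𝓘(ℂ)] [IsManifold 𝓘(ℂ) ω Y] in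
-- The quotient rule gives an expression homogeneous of degree zero in `w`, hence a function of the
-- ratio alone.
theorem hasDerivAt_ratio {i : Fin 2} {w : Fin 2 → ℂ} (hw : w i ≠ 0)
    (m : (Fin 2 → ℂ) →L[ℂ] (Fin 2 → ℂ)) :
    HasDerivAt (fun t : ℂ => (w + t • m w) (i + 1) / (w + t • m w) i)
      (affineField i m (w (i + 1) / w i)) 0 := by
  have h : ∀ j, HasDerivAt (fun t : ℂ => (w + t • m w) j) (m w j) 0 := fun j => by
    simpa using ((hasDerivAt_id (0 : ℂ)).mul_const (m w j)).const_add (w j)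
  have h0 : (w + (0 : ℂ) • m w) i ≠ 0 := by simpa using hw
  refine ((h (i + 1)).div (h i) h0).congr_deriv ?_
  simp only [zero_smul, add_zero, affineField]
  have h1 : m w = w i • m (vec i (w (i + 1) / w i)) := by
    conv_lhs => rw [eq_smul_vec i w hw]
    rw [map_smul]
  rw [h1]
  simp only [Pi.smul_apply, smul_eq_mul]
  field_simp

/-- For small `t` the `i`-th homogeneous coordinate stays nonzero, so the orbit remains in the
affine chart and is given there by a ratio. -/
theorem orbit_eventuallyEq {x₀ x : ProjBundle E} {i : Fin 2} (hx : x ∈ (affineChart x₀ i).source)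
    (A : E x.base →L[ℂ] E x.base) :
    orbit x A =ᶠ[𝓝 0] fun t => pt x₀ i x.base
      ((coord x₀.base x + t • endMatrix x₀.base x.base A (coord x₀.base x)) (i + 1) /
        (coord x₀.base x + t • endMatrix x₀.base x.base A (coord x₀.base x)) i) := by
  obtain ⟨y, l⟩ := x
  set w := coord x₀.base ⟨y, l⟩ with hw
  have hwi : w i ≠ 0 := hx.2
  set m := endMatrix x₀.base y A with hm
  have hc : Continuous fun t : ℂ => (w + t • m w) i := by
    simp only [Pi.add_apply, Pi.smul_apply]
    fun_prop
  have hev : ∀ᶠ t in 𝓝 (0 : ℂ), (w + t • m w) i ≠ 0 :=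
    hc.continuousAt.eventually_ne (by simpa using hwi)
  filter_upwards [hev] with t ht
  have htriv : triv x₀.base y (l.rep + t • A l.rep) = w + t • m w := by
    have h1 : m w = triv x₀.base y (A l.rep) := by
      rw [hm, endMatrix_apply, hw]
      change triv x₀.base y (A (trivSymm x₀.base y (triv x₀.base y l.rep))) = _
      rw [trivSymm_triv hx.1.2]
    rw [map_add, map_smul, h1]
    rfl
  have hne : l.rep + t • A l.rep ≠ 0 := fun h => by
    rw [h, map_zero] at htriv
    rw [← htriv] at ht
    exact ht rfl
  have horb : orbit ⟨y, l⟩ A t = ⟨y, Projectivization.mk ℂ _ hne⟩ := dif_pos hne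
  -- The chosen representative of the line is `a` times the given vector; the factor cancels in the
  -- ratio.
  obtain ⟨a, ha, hcoord⟩ := coord_mk (y₀ := x₀.base) _ hne
  rw [htriv] at hcoord
  have hi : coord x₀.base (⟨y, Projectivization.mk ℂ _ hne⟩ : ProjBundle E) i ≠ 0 := by
    rw [hcoord]
    exact mul_ne_zero ha ht
  rw [horb]
  refine (pt_coord (x₀ := x₀) (x := ⟨y, Projectivization.mk ℂ _ hne⟩) hx.1.2 hi).symm.trans ?_
  rw [hcoord]
  simp only [Pi.smul_apply, smul_eq_mul]
  rw [mul_div_mul_left _ _ ha]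

/-- The orbit stays in a fibre, so its first coordinate is constant; the second is the ratio of
`hasDerivAt_ratio`. -/
theorem mfderiv_affineChart_fundamentalVector {x₀ x : ProjBundle E} {i : Fin 2}
    (hx : x ∈ (affineChart x₀ i).source) (A : E x.base →L[ℂ] E x.base) :
    (mfderiv 𝓘(ℂ, ℂ × ℂ) 𝓘(ℂ, ℂ × ℂ) (affineChart x₀ i) x : (ℂ × ℂ) →L[ℂ] ℂ × ℂ)
      (fundamentalVector x A) =
      ((0, affineField i (endMatrix x₀.base x.base A) (affineChart x₀ i x).2) : ℂ × ℂ) := by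
  set w := coord x₀.base x with hw
  set m := endMatrix x₀.base x.base A with hm
  have hev := orbit_eventuallyEq hx A
  have hr := hasDerivAt_ratio (i := i) (w := w) hx.2 m
  have hd : MDifferentiableAt 𝓘(ℂ) 𝓘(ℂ, ℂ × ℂ) (orbit x A) 0 := by
    refine MDifferentiableAt.congr_of_eventuallyEq ?_ hev
    exact (((contMDiff_pt hx.1 (i := i)).contMDiffAt).mdifferentiableAt (by simp)).comp (0 : ℂ)
      hr.differentiableAt.mdifferentiableAt
  have hcomp : (affineChart x₀ i ∘ orbit x A) =ᶠ[𝓝 0]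
      fun t => (chartAt ℂ x₀.base x.base, (w + t • m w) (i + 1) / (w + t • m w) i) := by
    filter_upwards [hev] with t ht
    rw [Function.comp, ht, affineChart_pt hx.1]
  have hder : mfderiv 𝓘(ℂ) 𝓘(ℂ, ℂ × ℂ) (affineChart x₀ i ∘ orbit x A) 0 (1 : ℂ) =
      ((0, affineField i m (w (i + 1) / w i)) : ℂ × ℂ) := by
    rw [hcomp.mfderiv_eq, mfderiv_eq_fderiv]
    have := ((hasDerivAt_const (0 : ℂ) (chartAt ℂ x₀.base x.base)).prodMk hr).hasFDerivAt.fderiv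
    rw [this]
    exact one_smul ℂ _
  have hx' : orbit x A 0 ∈ (affineChart x₀ i).source := by rwa [orbit_zero]
  rw [mfderiv_comp (I' := 𝓘(ℂ, ℂ × ℂ)) (0 : ℂ)
    ((mdifferentiable_of_mem_atlas (affineChart_mem_atlas x₀ i)).mdifferentiableAt hx') hd] at hder
  -- The chain rule places the derivative of the chart at `orbit x A 0`, which is only
  -- propositionally `x`.
  have key : ∀ x', x' = x →
      (mfderiv 𝓘(ℂ, ℂ × ℂ) 𝓘(ℂ, ℂ × ℂ) (affineChart x₀ i) x' : (ℂ × ℂ) →L[ℂ] ℂ × ℂ) =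
      (mfderiv 𝓘(ℂ, ℂ × ℂ) 𝓘(ℂ, ℂ × ℂ) (affineChart x₀ i) x : (ℂ × ℂ) →L[ℂ] ℂ × ℂ) := by
    rintro _ rfl
    rfl
  rw [← key _ (orbit_zero x A)]
  exact hder

theorem coordForm₁_fundamentalVector {x₀ x : ProjBundle E} {i : Fin 2}
    (hx : x ∈ (affineChart x₀ i).source) (A : E x.base →L[ℂ] E x.base) :
    coordForm₁ (affineChart x₀ i) x (fundamentalVector x A) = 0 :=
  congrArg Prod.fst (mfderiv_affineChart_fundamentalVector hx A)

theorem coordForm₂_fundamentalVector {x₀ x : ProjBundle E} {i : Fin 2}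
    (hx : x ∈ (affineChart x₀ i).source) (A : E x.base →L[ℂ] E x.base) :
    coordForm₂ (affineChart x₀ i) x (fundamentalVector x A) =
      affineField i (endMatrix x₀.base x.base A) (affineChart x₀ i x).2 :=
  congrArg Prod.snd (mfderiv_affineChart_fundamentalVector hx A)

/-- The first coordinate of the affine chart is the coordinate of `Y` composed with the projection.
-/
theorem pullbackCovector_chartForm {x₀ x : ProjBundle E} {i : Fin 2}
    (hx : x ∈ (affineChart x₀ i).source) :
    pullbackCovector x (chartForm x₀.base x.base) = coordForm₁ (affineChart x₀ i) x := by
  rw [← scalarDiff_fst (affineChart_mem_atlas x₀ i) hx]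
  have hb : MDifferentiableAt 𝓘(ℂ, ℂ × ℂ) 𝓘(ℂ) (base : ProjBundle E → Y) x :=
    ((contMDiffOn_base_affineChart x₀ i).contMDiffAt
      ((affineChart x₀ i).open_source.mem_nhds hx)).mdifferentiableAt (by simp)
  exact (mfderiv_comp (I' := 𝓘(ℂ)) x ((mdifferentiable_chart x₀.base).mdifferentiableAt hx.1.1)
    hb).symm

end ProjBundle

variable [∀ y, IsTopologicalAddGroup (E y)] [∀ y, ContinuousSMul ℂ (E y)]

open ProjBundle

/-- The relation `Corresponds` at the point `x`. -/
def CorrespondsAt (x : ProjBundle E) (η : ⋀[ℂ]^2 (TangentSpace 𝓘(ℂ, ℂ × ℂ) x))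
    (t : TangentSpace 𝓘(ℂ) x.base ⊗[ℂ] End₀ E x.base) : Prop :=
  ∀ (α : TangentSpace 𝓘(ℂ) x.base →L[ℂ] ℂ) (β : TangentSpace 𝓘(ℂ, ℂ × ℂ) x →L[ℂ] ℂ),
    wedgePairing (pullbackCovector x α : Module.Dual ℂ (TangentSpace 𝓘(ℂ, ℂ × ℂ) x))
        (β : Module.Dual ℂ (TangentSpace 𝓘(ℂ, ℂ × ℂ) x)) η =
      β (fundamentalVector x (contract α t).1)

/-- In an affine chart, the correspondence expresses the coefficient of the bivector as the
vector field on the affine line given by the matrix of the endomorphism. -/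
theorem correspondsAt_iff {x₀ x : ProjBundle E} {i : Fin 2} (hx : x ∈ (affineChart x₀ i).source)
    (η : ⋀[ℂ]^2 (TangentSpace 𝓘(ℂ, ℂ × ℂ) x))
    (t : TangentSpace 𝓘(ℂ) x.base ⊗[ℂ] End₀ E x.base) :
    CorrespondsAt x η t ↔ bivCoeff (affineChart x₀ i) x η =
      affineField i (tensorMatrix x₀.base x.base t) (affineChart x₀ i x).2 := by
  constructor
  · intro h
    have := h (chartForm x₀.base x.base) (coordForm₂ (affineChart x₀ i) x)
    rw [pullbackCovector_chartForm hx, coordForm₂_fundamentalVector hx] at this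
    exact this
  · intro h α β
    -- With `α = a ds` and `β = b₁ ds + b₂ dz`, both sides equal `a b₂` times the two quantities
    -- equated by `h`: `ds ∧ ds` vanishes on the left, and `ds` kills the vertical vector on the
    -- right.
    rw [contract_eq hx.1.1 α t]
    have hα : pullbackCovector x α =
        α (chartField x₀.base x.base) • coordForm₁ (affineChart x₀ i) x := by
      rw [← pullbackCovector_chartForm hx]
      conv_lhs => rw [covector_eq_smul_chartForm hx.1.1 α]
      rfl
    rw [hα]
    set a := α (chartField x₀.base x.base)
    have hβ := covector_expand (affineChart_mem_atlas x₀ i) hx β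
    set b₁ := β (coordField (affineChart x₀ i) ((1, 0) : ℂ × ℂ) x)
    set b₂ := β (coordField (affineChart x₀ i) ((0, 1) : ℂ × ℂ) x)
    have hL : wedgePairing (a • (coordForm₁ (affineChart x₀ i) x :
        Module.Dual ℂ (TangentSpace 𝓘(ℂ, ℂ × ℂ) x)) + (0 : ℂ) • (coordForm₂ (affineChart x₀ i) x :
        Module.Dual ℂ (TangentSpace 𝓘(ℂ, ℂ × ℂ) x))) (b₁ • (coordForm₁ (affineChart x₀ i) x :
        Module.Dual ℂ (TangentSpace 𝓘(ℂ, ℂ × ℂ) x)) + b₂ • (coordForm₂ (affineChart x₀ i) x :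
        Module.Dual ℂ (TangentSpace 𝓘(ℂ, ℂ × ℂ) x))) η =
        (a * b₂ - 0 * b₁) * bivCoeff (affineChart x₀ i) x η := wedgePairing_comb _ _ _ _ _ _ _
    rw [zero_smul, add_zero, h] at hL
    rw [hβ]
    refine hL.trans ?_
    change _ = b₁ * coordForm₁ (affineChart x₀ i) x _ + b₂ * coordForm₂ (affineChart x₀ i) x _
    rw [coordForm₁_fundamentalVector hx, coordForm₂_fundamentalVector hx]
    have : endMatrix x₀.base x.base (a • contract (chartForm x₀.base x.base) t).1 =
        a • tensorMatrix x₀.base x.base t := endMatrix_smul _ _ _ _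
    rw [this]
    simp only [affineField, smul_apply, Pi.smul_apply, smul_eq_mul]
    ring

end Projective

/-! ### Vector fields on the projective line and traceless matrices. -/

section Quadratic

/-- The growth argument for sections of `𝒪(2)` on `ℙ¹`. -/
theorem eq_quadratic_of_differentiable {f g : ℂ → ℂ} (hf : Differentiable ℂ f)
    (hg : Differentiable ℂ g) (h : ∀ z, z ≠ 0 → f z = -z ^ 2 * g z⁻¹) (z : ℂ) :
    f z = f 0 + (f 1 - f 0 + g 0) * z - g 0 * z ^ 2 := by
  -- The second divided difference `(f z - f 0 - f'(0) z) / z²` is entire. By the gluing relation it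
  -- tends to `-g 0` at infinity, so Liouville's theorem makes it constant.
  have hk : Differentiable ℂ (dslope (dslope f 0) 0) := by
    have key : ∀ u : ℂ → ℂ, Differentiable ℂ u → Differentiable ℂ (dslope u 0) := by
      intro u hu
      rw [← differentiableOn_univ] at hu ⊢
      exact (Complex.differentiableOn_dslope Filter.univ_mem).2 hu
    exact key _ (key _ hf)
  have hval : ∀ z, z ≠ 0 → dslope (dslope f 0) 0 z =
      -g z⁻¹ - f 0 * (z⁻¹) ^ 2 - deriv f 0 * z⁻¹ := by
    intro z hz
    rw [dslope_of_ne _ hz, slope_def_field, dslope_same, dslope_of_ne _ hz, slope_def_field, h z hz]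
    field_simp
    ring
  have hlim : Filter.Tendsto (dslope (dslope f 0) 0) (Filter.cocompact ℂ) (𝓝 (-g 0)) := by
    have hinv : Filter.Tendsto (fun z : ℂ => z⁻¹) (Filter.cocompact ℂ) (𝓝 0) :=
      Filter.tendsto_inv₀_cobounded.mono_left (Metric.cobounded_eq_cocompact (α := ℂ)).ge
    have hG : Continuous fun s : ℂ => -g s - f 0 * s ^ 2 - deriv f 0 * s := by
      have := hg.continuous
      fun_prop
    have := (hG.tendsto 0).comp hinv
    simp only [ne_eq, OfNat.ofNat_ne_zero, not_false_eq_true, zero_pow, mul_zero, sub_zero] at this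
    refine this.congr' ?_
    have hne : ∀ᶠ z : ℂ in Filter.cocompact ℂ, z ≠ 0 := by
      have : ({0}ᶜ : Set ℂ) ∈ Filter.cocompact ℂ := isCompact_singleton.compl_mem_cocompact
      exact this
    filter_upwards [hne] with z hz
    exact (hval z hz).symm
  have hconst : ∀ z, dslope (dslope f 0) 0 z = -g 0 := fun z =>
    hk.apply_eq_of_tendsto_cocompact z hlim
  have hquad : ∀ z, f z = f 0 + deriv f 0 * z - g 0 * z ^ 2 := by
    intro z
    rcases eq_or_ne z 0 with rfl | hz
    · simp
    have h1 := hconst z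
    rw [dslope_of_ne _ hz, slope_def_field, dslope_same, dslope_of_ne _ hz, slope_def_field] at h1
    field_simp at h1
    linear_combination h1
  -- Evaluation at `1` replaces `f'(0)` by values of `f` and `g`.
  have h1 := hquad 1
  rw [hquad z]
  linear_combination z * (-h1)

/-- The traceless matrix inducing the vector field `p + r z - q z²` on the affine line. -/
def quadMatrix (p q r : ℂ) : (Fin 2 → ℂ) →L[ℂ] (Fin 2 → ℂ) :=
  p • (ContinuousLinearMap.proj (R := ℂ) (φ := fun _ : Fin 2 => ℂ) 0).smulRight (Pi.single 1 1) +
  q • (ContinuousLinearMap.proj (R := ℂ) (φ := fun _ : Fin 2 => ℂ) 1).smulRight (Pi.single 0 1) +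
  (r / 2) •
    ((ContinuousLinearMap.proj (R := ℂ) (φ := fun _ : Fin 2 => ℂ) 1).smulRight (Pi.single 1 1) -
      (ContinuousLinearMap.proj (R := ℂ) (φ := fun _ : Fin 2 => ℂ) 0).smulRight (Pi.single 0 1))

theorem quadMatrix_apply_zero (p q r : ℂ) (w : Fin 2 → ℂ) :
    quadMatrix p q r w 0 = q * w 1 - r / 2 * w 0 := by
  simp [quadMatrix]
  ring

theorem quadMatrix_apply_one (p q r : ℂ) (w : Fin 2 → ℂ) :
    quadMatrix p q r w 1 = p * w 0 + r / 2 * w 1 := by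
  simp [quadMatrix]

theorem trace_eq (m : (Fin 2 → ℂ) →L[ℂ] (Fin 2 → ℂ)) :
    LinearMap.trace ℂ _ (m : (Fin 2 → ℂ) →ₗ[ℂ] (Fin 2 → ℂ)) =
      m (Pi.single 0 1) 0 + m (Pi.single 1 1) 1 := by
  rw [LinearMap.trace_eq_matrix_trace ℂ (Pi.basisFun ℂ (Fin 2)), Matrix.trace_fin_two]
  simp

theorem trace_quadMatrix (p q r : ℂ) :
    LinearMap.trace ℂ _ (quadMatrix p q r : (Fin 2 → ℂ) →ₗ[ℂ] (Fin 2 → ℂ)) = 0 := by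
  rw [trace_eq, quadMatrix_apply_zero, quadMatrix_apply_one]
  simp

open ProjBundle

theorem affineField_zero_quadMatrix (p q r z : ℂ) :
    affineField 0 (quadMatrix p q r) z = p + r * z - q * z ^ 2 := by
  have h : ((0 : Fin 2) + 1) = 1 := rfl
  rw [affineField, h, quadMatrix_apply_zero, quadMatrix_apply_one]
  simp [vec]
  ring

/-- This is the field `p + r z - q z²` in the coordinate `u = 1/z`: there `p` and `q` are exchanged
and `r` changes sign. -/
theorem affineField_one_quadMatrix (p q r z : ℂ) :
    affineField 1 (quadMatrix p q r) z = q - r * z - p * z ^ 2 := by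
  have h : ((1 : Fin 2) + 1) = 0 := rfl
  rw [affineField, h, quadMatrix_apply_zero, quadMatrix_apply_one]
  simp [vec]
  ring

/-- The induced field sees the off-diagonal entries and the difference of the diagonal ones, that
is, the matrix modulo scalars; vanishing trace fixes the scalar. The evaluation points are those of
`eq_quadratic_of_differentiable`. -/
theorem eq_quadMatrix {m : (Fin 2 → ℂ) →L[ℂ] (Fin 2 → ℂ)}
    (hm : LinearMap.trace ℂ _ (m : (Fin 2 → ℂ) →ₗ[ℂ] (Fin 2 → ℂ)) = 0) :
    m = quadMatrix (affineField 0 m 0) (affineField 1 m 0)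
      (affineField 0 m 1 - affineField 0 m 0 + affineField 1 m 0) := by
  have hv : ∀ w : Fin 2 → ℂ, w = w 0 • Pi.single 0 1 + w 1 • Pi.single 1 1 := by
    intro w
    funext j
    fin_cases j <;> simp
  have hmv : ∀ w j, m w j = w 0 * m (Pi.single 0 1) j + w 1 * m (Pi.single 1 1) j := by
    intro w j
    conv_lhs => rw [hv w, map_add, map_smul, map_smul]
    rfl
  rw [trace_eq] at hm
  have h0 : ((0 : Fin 2) + 1) = 1 := rfl
  have h1 : ((1 : Fin 2) + 1) = 0 := rfl
  have e1 : affineField 0 m 0 = m (Pi.single 0 1) 1 := by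
    rw [affineField, h0, hmv]
    simp [vec]
  have e2 : affineField 1 m 0 = m (Pi.single 1 1) 0 := by
    rw [affineField, h1, hmv]
    simp [vec]
  have e3 : affineField 0 m 1 = m (Pi.single 0 1) 1 + m (Pi.single 1 1) 1
      - m (Pi.single 0 1) 0 - m (Pi.single 1 1) 0 := by
    rw [affineField, h0, hmv, hmv _ 0]
    simp [vec]
    ring
  ext1 w
  funext j
  fin_cases j
  · change m w 0 = quadMatrix _ _ _ w 0
    rw [quadMatrix_apply_zero, hmv, e1, e2, e3]
    linear_combination w 0 / 2 * hm
  · change m w 1 = quadMatrix _ _ _ w 1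
    rw [quadMatrix_apply_one, hmv, e1, e2, e3]
    linear_combination w 1 / 2 * hm

end Quadratic

/-! ### The correspondence between bivector fields and sections. -/

section Correspondence

variable {Y : Type*} [TopologicalSpace Y] [ChartedSpace ℂ Y] [IsManifold 𝓘(ℂ) ω Y]
  {E : Y → Type*} [∀ y, AddCommGroup (E y)] [∀ y, Module ℂ (E y)]
  [∀ y, TopologicalSpace (E y)] [TopologicalSpace (Bundle.TotalSpace (Fin 2 → ℂ) E)]
  [FiberBundle (Fin 2 → ℂ) E] [VectorBundle ℂ (Fin 2 → ℂ) E]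
  [ContMDiffVectorBundle ω (Fin 2 → ℂ) E 𝓘(ℂ)]

open ProjBundle

/-- The coefficients of a bivector in the two affine charts of a fibre. -/
theorem bivCoeff_affineChart_one {x₀ x : ProjBundle E} (hx₀ : x ∈ (affineChart x₀ 0).source)
    (hx₁ : x ∈ (affineChart x₀ 1).source) (η : ⋀[ℂ]^2 (TangentSpace 𝓘(ℂ, ℂ × ℂ) x)) :
    bivCoeff (affineChart x₀ 1) x η =
      -((affineChart x₀ 0 x).2 ^ 2)⁻¹ * bivCoeff (affineChart x₀ 0) x η := by
  have hz : (affineChart x₀ 0 x).2 ≠ 0 := div_ne_zero hx₁.2 hx₀.2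
  have hs : coordForm₁ (affineChart x₀ 1) x = coordForm₁ (affineChart x₀ 0) x := by
    rw [← pullbackCovector_chartForm hx₀, ← pullbackCovector_chartForm hx₁]
  have ho : IsOpen ((affineChart x₀ 0).source ∩ (affineChart x₀ 1).source) :=
    (affineChart x₀ 0).open_source.inter (affineChart x₀ 1).open_source
  -- The second coordinates of the two charts are inverse to each other, and `d(1/z) = -z⁻² dz`.
  have hz' : coordForm₂ (affineChart x₀ 1) x =
      -((affineChart x₀ 0 x).2 ^ 2)⁻¹ • coordForm₂ (affineChart x₀ 0) x := by
    rw [← scalarDiff_snd (affineChart_mem_atlas x₀ 1) hx₁,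
      ← scalarDiff_snd (affineChart_mem_atlas x₀ 0) hx₀]
    have hev : (fun x => (affineChart x₀ 1 x).2) =ᶠ[𝓝 x]
        (fun z : ℂ => z⁻¹) ∘ fun x => (affineChart x₀ 0 x).2 := by
      filter_upwards [ho.mem_nhds ⟨hx₀, hx₁⟩] with x' hx'
      rw [Function.comp, affineChart_apply, affineChart_apply]
      exact (inv_div _ _).symm
    have h1 : HasMFDerivAt 𝓘(ℂ) 𝓘(ℂ) (fun z : ℂ => z⁻¹) ((affineChart x₀ 0 x).2)
        (ContinuousLinearMap.toSpanSingleton ℂ (-((affineChart x₀ 0 x).2 ^ 2)⁻¹)) :=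
      (hasDerivAt_inv hz).hasFDerivAt.hasMFDerivAt
    have h2 : MDifferentiableAt 𝓘(ℂ, ℂ × ℂ) 𝓘(ℂ) (fun x => (affineChart x₀ 0 x).2) x :=
      ((contMDiffOn_snd_chart (affineChart_mem_atlas x₀ 0)).contMDiffAt
        ((affineChart x₀ 0).open_source.mem_nhds hx₀)).mdifferentiableAt (by simp)
    have h3 := (h1.comp x h2.hasMFDerivAt).mfderiv
    refine (hev.mfderiv_eq.trans h3).trans ?_
    refine ContinuousLinearMap.ext fun v => ?_
    exact mul_comm (scalarDiff (V := ℂ × ℂ) (fun x => (affineChart x₀ 0 x).2) x v) _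
  unfold bivCoeff
  rw [hs, hz']
  exact wedgePairing_smul_right _ _ _ _

variable [∀ y, IsTopologicalAddGroup (E y)] [∀ y, ContinuousSMul ℂ (E y)]

omit [ContMDiffVectorBundle ω (Fin 2 → ℂ) E 𝓘(ℂ)] in
theorem trace_tensorMatrix {y₀ y : Y} (hy : y ∈ dom E y₀)
    (t : TangentSpace 𝓘(ℂ) y ⊗[ℂ] End₀ E y) :
    LinearMap.trace ℂ _ (tensorMatrix y₀ y t : (Fin 2 → ℂ) →ₗ[ℂ] (Fin 2 → ℂ)) = 0 :=
  (trace_endMatrix hy.2 _).trans (contract (chartForm y₀ y) t).2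

/-- The coefficient at the point with coordinate `z` of the fibre over `y`. -/
def fibreCoeff (η : bivectorFields (ℂ × ℂ) (ProjBundle E)) (x₀ : ProjBundle E) (i : Fin 2) (y : Y)
    (z : ℂ) : ℂ := bivCoeff (affineChart x₀ i) (pt x₀ i y z) (η.1 (pt x₀ i y z))

theorem differentiable_fibreCoeff (η : bivectorFields (ℂ × ℂ) (ProjBundle E)) {x₀ : ProjBundle E}
    (i : Fin 2) {y : Y} (hy : y ∈ dom E x₀.base) : Differentiable ℂ (fibreCoeff η x₀ i y) := by
  have h := (contMDiffOn_bivCoeff (affineChart_mem_atlas x₀ i) η).comp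
    ((contMDiff_pt hy (i := i)).contMDiffOn (s := Set.univ)) (fun z _ => pt_mem_source hy z)
  rw [contMDiffOn_univ] at h
  exact h.contDiff.differentiable (by simp)

theorem contMDiffOn_fibreCoeff (η : bivectorFields (ℂ × ℂ) (ProjBundle E)) (x₀ : ProjBundle E)
    (i : Fin 2) (z : ℂ) :
    ContMDiffOn 𝓘(ℂ) 𝓘(ℂ) ω (fun y => fibreCoeff η x₀ i y z) (dom E x₀.base) :=
  (contMDiffOn_bivCoeff (affineChart_mem_atlas x₀ i) η).comp (contMDiffOn_pt x₀ i z)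
    (fun _ hy => pt_mem_source hy z)

/-- A bivector field and a section that correspond, in terms of an affine chart. -/
theorem fibreCoeff_eq {η : bivectorFields (ℂ × ℂ) (ProjBundle E)}
    {φ : ∀ y : Y, TangentSpace 𝓘(ℂ) y ⊗[ℂ] End₀ E y}
    (h : ∀ x, CorrespondsAt x (η.1 x) (φ x.base)) (x₀ : ProjBundle E) (i : Fin 2) {y : Y}
    (hy : y ∈ dom E x₀.base) (z : ℂ) :
    fibreCoeff η x₀ i y z = affineField i (tensorMatrix x₀.base y (φ y)) z := by
  have := (correspondsAt_iff (pt_mem_source hy z) _ _).1 (h (pt x₀ i y z))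
  rw [fibreCoeff, this, affineChart_pt hy, pt_base hy]

/-- The section is recovered from three values of the coefficients of `η`. This yields both its
uniqueness and its holomorphy. -/
theorem tensorMatrix_eq {η : bivectorFields (ℂ × ℂ) (ProjBundle E)}
    {φ : ∀ y : Y, TangentSpace 𝓘(ℂ) y ⊗[ℂ] End₀ E y}
    (h : ∀ x, CorrespondsAt x (η.1 x) (φ x.base)) (x₀ : ProjBundle E) {y : Y}
    (hy : y ∈ dom E x₀.base) :
    tensorMatrix x₀.base y (φ y) = quadMatrix (fibreCoeff η x₀ 0 y 0) (fibreCoeff η x₀ 1 y 0)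
      (fibreCoeff η x₀ 0 y 1 - fibreCoeff η x₀ 0 y 0 + fibreCoeff η x₀ 1 y 0) := by
  simp only [fibreCoeff_eq h x₀ _ hy]
  exact eq_quadMatrix (trace_tensorMatrix hy _)

/-- The coefficients of `η` on the two affine lines of the fibre are entire and glue as a section of
`𝒪(2)`, so they form the field of a traceless matrix; that matrix gives the endomorphism. -/
theorem exists_tensor_correspondsAt (η : bivectorFields (ℂ × ℂ) (ProjBundle E)) (y : Y) :
    ∃ t : TangentSpace 𝓘(ℂ) y ⊗[ℂ] End₀ E y, ∀ (l : Projectivization ℂ (E y)),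
      CorrespondsAt (⟨y, l⟩ : ProjBundle E) (η.1 ⟨y, l⟩) t := by
  set x₀ := pointOver E y with hx₀
  have hy : y ∈ dom E x₀.base := mem_dom y
  set f := fibreCoeff η x₀ 0 y with hf
  set g := fibreCoeff η x₀ 1 y with hg
  -- For `z ≠ 0` the same point has coordinate `z⁻¹` in the other chart, and
  -- `bivCoeff_affineChart_one` compares the coefficients there.
  have hfg : ∀ z, z ≠ 0 → f z = -z ^ 2 * g z⁻¹ := by
    intro z hz
    have hx0 : pt x₀ 0 y z ∈ (affineChart x₀ 0).source := pt_mem_source hy z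
    have hc : (affineChart x₀ 0 (pt x₀ 0 y z)).2 = z := by rw [affineChart_pt hy]
    have hx1 : pt x₀ 0 y z ∈ (affineChart x₀ 1).source := by
      refine ⟨hx0.1, fun h0 => hz ?_⟩
      rw [← hc, affineChart_apply]
      change coord x₀.base (pt x₀ 0 y z) 1 / _ = 0
      rw [h0, zero_div]
    have hpt : pt x₀ 1 y z⁻¹ = pt x₀ 0 y z := by
      have h1 := pt_affineChart hx1
      rw [pt_base hy] at h1
      have h2 : (affineChart x₀ 1 (pt x₀ 0 y z)).2 = z⁻¹ := by
        conv_rhs => rw [← hc, affineChart_apply]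
        rw [affineChart_apply]
        exact (inv_div _ _).symm
      rwa [h2] at h1
    have hb := bivCoeff_affineChart_one hx0 hx1 (η.1 (pt x₀ 0 y z))
    rw [hc] at hb
    rw [hf, hg, fibreCoeff, fibreCoeff, hpt, hb]
    field_simp
  have hquad := eq_quadratic_of_differentiable (differentiable_fibreCoeff η 0 hy)
    (differentiable_fibreCoeff η 1 hy) hfg
  set m := quadMatrix (f 0) (g 0) (f 1 - f 0 + g 0) with hm
  let t : TangentSpace 𝓘(ℂ) y ⊗[ℂ] End₀ E y :=
    chartField y y ⊗ₜ end₀OfMatrix hy.2 m (trace_quadMatrix _ _ _)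
  have ht : tensorMatrix x₀.base y t = m := by
    have h1 : contract (chartForm y y) t = end₀OfMatrix hy.2 m (trace_quadMatrix _ _ _) := by
      rw [contract_tmul, chartForm_chartField (mem_chart_source ℂ y), one_smul]
    change endMatrix y y (contract (chartForm y y) t).1 = m
    rw [h1]
    exact endMatrix_endOfMatrix hy.2 m
  refine ⟨t, fun l => ?_⟩
  -- Only one point of the fibre lies outside the first chart: the origin of the second, where the
  -- coefficient is `g 0`.
  by_cases h0 : coord x₀.base (⟨y, l⟩ : ProjBundle E) 0 = 0
  · have h1 : coord x₀.base (⟨y, l⟩ : ProjBundle E) 1 ≠ 0 := fun h1 => by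
      refine coord_ne_zero (x := (⟨y, l⟩ : ProjBundle E)) hy.2 (funext fun j => ?_)
      fin_cases j
      · exact h0
      · exact h1
    have hx : (⟨y, l⟩ : ProjBundle E) ∈ (affineChart x₀ 1).source := ⟨hy, h1⟩
    rw [correspondsAt_iff hx]
    change _ = affineField 1 (tensorMatrix x₀.base y t) _
    have hc : (affineChart x₀ 1 (⟨y, l⟩ : ProjBundle E)).2 = 0 := by
      rw [affineChart_apply]
      change coord x₀.base (⟨y, l⟩ : ProjBundle E) 0 / _ = 0
      rw [h0, zero_div]
    have hp : pt x₀ 1 y 0 = ⟨y, l⟩ := by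
      have := pt_affineChart hx
      rwa [hc] at this
    rw [hc, ht, hm, affineField_one_quadMatrix, hg, fibreCoeff, hp]
    ring
  · have hx : (⟨y, l⟩ : ProjBundle E) ∈ (affineChart x₀ 0).source := ⟨hy, h0⟩
    rw [correspondsAt_iff hx]
    change _ = affineField 0 (tensorMatrix x₀.base y t) _
    rw [ht, hm, affineField_zero_quadMatrix, ← hquad, fibreCoeff]
    have hp : pt x₀ 0 y (affineChart x₀ 0 (⟨y, l⟩ : ProjBundle E)).2 = ⟨y, l⟩ := pt_affineChart hx
    rw [hp]

theorem contMDiffOn_quadMatrix {s : Set Y} {p q r : Y → ℂ} (hp : ContMDiffOn 𝓘(ℂ) 𝓘(ℂ) ω p s)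
    (hq : ContMDiffOn 𝓘(ℂ) 𝓘(ℂ) ω q s) (hr : ContMDiffOn 𝓘(ℂ) 𝓘(ℂ) ω r s) :
    ContMDiffOn 𝓘(ℂ) 𝓘(ℂ, (Fin 2 → ℂ) →L[ℂ] (Fin 2 → ℂ)) ω
      (fun y => quadMatrix (p y) (q y) (r y)) s := by
  have hr' : ContMDiffOn 𝓘(ℂ) 𝓘(ℂ) ω (fun y => r y / 2) s :=
    (contDiff_id.div_const (2 : ℂ)).contMDiff.comp_contMDiffOn hr
  exact ((hp.smul contMDiffOn_const).add (hq.smul contMDiffOn_const)).add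
    (hr'.smul contMDiffOn_const)

/-- The tensors are chosen fibre by fibre. Holomorphy follows because `tensorMatrix_eq` forces their
matrices to be combinations of coefficients of `η` along local sections of `ℙ(E)`. -/
theorem exists_section_corresponds (η : bivectorFields (ℂ × ℂ) (ProjBundle E)) :
    ∃ φ : vectorTensorEnd₀ E, Corresponds η φ := by
  choose φ hφ using exists_tensor_correspondsAt η
  have h : ∀ x : ProjBundle E, CorrespondsAt x (η.1 x) (φ x.base) := fun x => hφ x.base x.line
  refine ⟨⟨φ, mem_vectorTensorEnd₀ fun y₀ => ?_⟩, h⟩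
  refine ContMDiffOn.congr ?_ fun y hy => tensorMatrix_eq h (pointOver E y₀) hy
  exact contMDiffOn_quadMatrix (contMDiffOn_fibreCoeff η _ 0 0) (contMDiffOn_fibreCoeff η _ 1 0)
    (((contMDiffOn_fibreCoeff η _ 0 1).sub (contMDiffOn_fibreCoeff η _ 0 0)).add
      (contMDiffOn_fibreCoeff η _ 1 0))

theorem Corresponds.section_unique {η : bivectorFields (ℂ × ℂ) (ProjBundle E)}
    {φ φ' : vectorTensorEnd₀ E} (h : Corresponds η φ) (h' : Corresponds η φ') : φ = φ' := by
  refine Subtype.ext (funext fun y => tensorMatrix_injective (mem_dom y) ?_)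
  exact (tensorMatrix_eq h (pointOver E y) (mem_dom y)).trans
    (tensorMatrix_eq h' (pointOver E y) (mem_dom y)).symm

theorem mem_affineChart_idx (x : ProjBundle E) : x ∈ (affineChart x (idx x)).source :=
  ⟨mem_dom x.base, coord_idx x⟩

theorem Corresponds.bivector_unique {η η' : bivectorFields (ℂ × ℂ) (ProjBundle E)}
    {φ : vectorTensorEnd₀ E} (h : Corresponds η φ) (h' : Corresponds η' φ) : η = η' := by
  refine Subtype.ext (funext fun x => ?_)
  have hx := mem_affineChart_idx x
  have hea := affineChart_mem_atlas x (idx x)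
  rw [eq_bivCoeff_smul hea hx (η.1 x), eq_bivCoeff_smul hea hx (η'.1 x),
    (correspondsAt_iff hx _ _).1 (h x), (correspondsAt_iff hx _ _).1 (h' x)]

/-- The bivector at `x` is defined by the coefficient that `correspondsAt_iff` demands in one chart
at `x`. The relation is chart-free, so the same formula gives the coefficient in a fixed chart and
shows that it is holomorphic. -/
theorem exists_bivector_corresponds (φ : vectorTensorEnd₀ E) :
    ∃ η : bivectorFields (ℂ × ℂ) (ProjBundle E), Corresponds η φ := by
  let η (x : ProjBundle E) : ⋀[ℂ]^2 (TangentSpace 𝓘(ℂ, ℂ × ℂ) x) :=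
    affineField (idx x) (tensorMatrix x.base x.base (φ.1 x.base)) (affineChart x (idx x) x).2 •
      coordBiv (affineChart x (idx x)) x
  have h : ∀ x : ProjBundle E, CorrespondsAt x (η x) (φ.1 x.base) := by
    intro x
    have hx := mem_affineChart_idx x
    rw [correspondsAt_iff hx]
    refine (wedgePairing_smul _ _ _ _).trans ?_
    change _ * bivCoeff (affineChart x (idx x)) x (coordBiv (affineChart x (idx x)) x) = _
    rw [bivCoeff_coordBiv (affineChart_mem_atlas x (idx x)) hx, mul_one]
  refine ⟨⟨η, mem_bivectorFields fun x₀ => ⟨affineChart x₀ (idx x₀), affineChart_mem_atlas _ _,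
    mem_affineChart_idx x₀, ?_⟩⟩, h⟩
  set e := affineChart x₀ (idx x₀)
  refine ContMDiffOn.congr ?_ fun x hx => (correspondsAt_iff hx _ _).1 (h x)
  have hM : ContMDiffOn 𝓘(ℂ, ℂ × ℂ) 𝓘(ℂ, (Fin 2 → ℂ) →L[ℂ] (Fin 2 → ℂ)) ω
      (fun x : ProjBundle E => tensorMatrix x₀.base x.base (φ.1 x.base)) e.source :=
    (contMDiffOn_tensorMatrix φ x₀.base).comp (contMDiffOn_base_affineChart x₀ (idx x₀))
      fun x hx => hx.1
  have hz := contMDiffOn_snd_chart (affineChart_mem_atlas x₀ (idx x₀))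
  have hv : ContMDiffOn 𝓘(ℂ, ℂ × ℂ) 𝓘(ℂ, Fin 2 → ℂ) ω
      (fun x : ProjBundle E => vec (idx x₀) (e x).2) e.source :=
    (contDiff_vec (idx x₀)).contMDiff.comp_contMDiffOn hz
  have hmv := hM.clm_apply hv
  have hj : ∀ j, ContMDiffOn 𝓘(ℂ, ℂ × ℂ) 𝓘(ℂ) ω (fun x : ProjBundle E =>
      tensorMatrix x₀.base x.base (φ.1 x.base) (vec (idx x₀) (e x).2) j) e.source := fun j =>
    (ContinuousLinearMap.proj (R := ℂ) (φ := fun _ : Fin 2 => ℂ) j).contMDiff.comp_contMDiffOn hmv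
  exact (hj _).sub (hz.mul (hj _))

theorem CorrespondsAt.add {x : ProjBundle E} {η η' : ⋀[ℂ]^2 (TangentSpace 𝓘(ℂ, ℂ × ℂ) x)}
    {t t' : TangentSpace 𝓘(ℂ) x.base ⊗[ℂ] End₀ E x.base} (h : CorrespondsAt x η t)
    (h' : CorrespondsAt x η' t') : CorrespondsAt x (η + η') (t + t') := by
  have hx := mem_affineChart_idx x
  rw [correspondsAt_iff hx] at h h' ⊢
  refine (wedgePairing_add _ _ _ _).trans ((congrArg₂ _ h h').trans ?_)
  rw [tensorMatrix_add]
  simp only [affineField, add_apply, Pi.add_apply]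
  ring

theorem CorrespondsAt.smul {x : ProjBundle E} {η : ⋀[ℂ]^2 (TangentSpace 𝓘(ℂ, ℂ × ℂ) x)}
    {t : TangentSpace 𝓘(ℂ) x.base ⊗[ℂ] End₀ E x.base} (c : ℂ) (h : CorrespondsAt x η t) :
    CorrespondsAt x (c • η) (c • t) := by
  have hx := mem_affineChart_idx x
  rw [correspondsAt_iff hx] at h ⊢
  refine (wedgePairing_smul _ _ _ _).trans ((congrArg (c * ·) h).trans ?_)
  rw [tensorMatrix_smul]
  simp only [affineField, smul_apply, Pi.smul_apply, smul_eq_mul]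
  ring

variable (E) in
/-- Bivector fields on `ℙ(E)` and sections of `T_Y ⊗ End₀(E)` are isomorphic through the
relation `Corresponds`. -/
theorem exists_linearEquiv_corresponds :
    ∃ Φ : bivectorFields (ℂ × ℂ) (ProjBundle E) ≃ₗ[ℂ] vectorTensorEnd₀ E,
      ∀ η, Corresponds η (Φ η) := by
  choose F hF using exists_section_corresponds (E := E)
  choose G hG using exists_bivector_corresponds (E := E)
  -- Linearity and the inverse laws all come from uniqueness, as the relation is additive and
  -- homogeneous.
  exact ⟨{ toFun := F
           map_add' := fun η η' => (hF (η + η')).section_unique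
            fun x => CorrespondsAt.add (hF η x) (hF η' x)
           map_smul' := fun c η => (hF (c • η)).section_unique
            fun x => CorrespondsAt.smul c (hF η x)
           invFun := G
           left_inv := fun η => (hG (F η)).bivector_unique (hF η)
           right_inv := fun φ => (hF (G φ)).section_unique (hG φ) }, hF⟩

end Correspondence

end RuledSurface

end

/-! ### The main theorem. -/

theorem mainTheorem7 {Y : Type*} [TopologicalSpace Y] [ChartedSpace ℂ Y] [IsManifold 𝓘(ℂ) ω Y]
    (E : Y → Type*) [∀ y, AddCommGroup (E y)] [∀ y, Module ℂ (E y)]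
    [∀ y, TopologicalSpace (E y)] [∀ y, IsTopologicalAddGroup (E y)]
    [∀ y, ContinuousSMul ℂ (E y)]
    [TopologicalSpace (Bundle.TotalSpace (Fin 2 → ℂ) E)] [FiberBundle (Fin 2 → ℂ) E]
    [VectorBundle ℂ (Fin 2 → ℂ) E] [ContMDiffVectorBundle ω (Fin 2 → ℂ) E 𝓘(ℂ)] :
    (∃! Φ : RuledSurface.bivectorFields (ℂ × ℂ) (RuledSurface.ProjBundle E) ≃ₗ[ℂ]
        RuledSurface.vectorTensorEnd₀ E,
      ∀ η, RuledSurface.Corresponds η (Φ η)) ∧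
    (∃! Ψ : RuledSurface.PoissonStructure (ℂ × ℂ) (RuledSurface.ProjBundle E) ≃
        RuledSurface.CotangentToEnd₀ E,
      ∀ P, ∃ (η : RuledSurface.bivectorFields (ℂ × ℂ) (RuledSurface.ProjBundle E))
        (φ : RuledSurface.vectorTensorEnd₀ E),
        P.EncodedBy η ∧ RuledSurface.Corresponds η φ ∧
          ∀ (y : Y) (α : TangentSpace 𝓘(ℂ) y →L[ℂ] ℂ),
            (Ψ P).1 y α = RuledSurface.contract α (φ.1 y)) := by
  obtain ⟨Φ, hΦ⟩ := RuledSurface.exists_linearEquiv_corresponds E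
  choose b hb using RuledSurface.exists_bivector_encodedBy (M := RuledSurface.ProjBundle E)
  choose p hp using RuledSurface.exists_poisson_encodedBy (M := RuledSurface.ProjBundle E)
  choose m hm using RuledSurface.exists_bundleMap_of_section (E := E)
  choose s hs using RuledSurface.exists_section_of_bundleMap (E := E)
  have ext : ∀ θ θ' : RuledSurface.CotangentToEnd₀ E,
      (∀ (y : Y) (α : TangentSpace 𝓘(ℂ) y →L[ℂ] ℂ), θ.1 y α = θ'.1 y α) → θ = θ' :=
    fun θ θ' h => Subtype.ext (funext fun y => ContinuousLinearMap.ext (h y))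
  refine ⟨⟨Φ, hΦ, fun Φ' h' => LinearEquiv.ext fun η => (h' η).section_unique (hΦ η)⟩, ?_⟩
  let Ψ : RuledSurface.PoissonStructure (ℂ × ℂ) (RuledSurface.ProjBundle E) ≃
      RuledSurface.CotangentToEnd₀ E :=
    { toFun := fun P => m (Φ (b P))
      invFun := fun θ => p (Φ.symm (s θ))
      left_inv := fun P => by
        -- Contractions with covectors separate tensors, so `s` inverts `m`.
        have h1 : s (m (Φ (b P))) = Φ (b P) := Subtype.ext (funext fun y =>
          RuledSurface.eq_of_contract_eq fun α => by rw [← hs, hm])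
        have h2 := hp (Φ.symm (s (m (Φ (b P)))))
        rw [h1, Φ.symm_apply_apply] at h2
        change p (Φ.symm (s (m (Φ (b P))))) = P
        rw [h1, Φ.symm_apply_apply]
        exact h2.eq (hb P)
      right_inv := fun θ => by
        have h1 : b (p (Φ.symm (s θ))) = Φ.symm (s θ) := (hb _).eq_bivector (hp _)
        change m (Φ (b (p (Φ.symm (s θ))))) = θ
        rw [h1, Φ.apply_symm_apply]
        exact ext _ _ fun y α => by rw [hm, hs] }
  refine ⟨Ψ, fun P => ⟨b P, Φ (b P), hb P, hΦ _, hm _⟩, fun Ψ' h' => Equiv.ext fun P => ?_⟩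
  -- The witnesses are forced: `P` determines `η`, and `η` determines `φ`, so `Ψ'` agrees with `Ψ`
  -- on every covector.
  obtain ⟨η, φ, h1, h2, h3⟩ := h' P
  have h4 : η = b P := h1.eq_bivector (hb P)
  subst h4
  have h5 : φ = Φ (b P) := h2.section_unique (hΦ _)
  subst h5
  exact ext _ _ fun y α => (h3 y α).trans (hm _ y α).symm
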